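/- Let $\Omega\subset\mathbb R^2$ be a bounded polygonal domain with a finite conforming triangular mesh $\mathcal T_h$ (closed nondegenerate triangles $K$ with pairwise disjoint interiors contained in $\Omega$, covering $\overline\Omega$, any two of which meet in the empty set, a common vertex or a common edge), and let $k\ge 1$. Put $P_{-1}=\{0\}$ and let $\mathbb B_k(\partial K)$ be the set of continuous functions on $\partial K$ that are polynomials of degree at most $k$ on each edge of $K$. The virtual element space is $$\tilde V_h=\{\tilde v\in H^1_0(\Omega):\ \tilde v|_{\partial K}\in\mathbb B_k(\partial K),\ \Delta\tilde v|_K\in P_{k-2}(K)\ \text{ for all }K\in\mathcal T_h\}.$$ Split each $K$ into three triangles $K_1,K_2,K_3$ by joining its barycenter to its vertices, and let $$\mathbb V_k(K)=\{w\in C(K):\ w|_{K_i}\in P_k(K_i),\ i=1,2,3\}.$$ For $\tilde v\in\tilde V_h$ let $v_h=\Pi_h^\nabla\tilde v$ be the function with $v_h|_K\in\mathbb V_k(K)$ and, for every $K\in\mathcal T_h$, $$v_h=\tilde v\ \text{ on }\partial K,\qquad (\nabla v_h,\nabla w_h)_K=(\nabla\tilde v,\nabla w_h)_K\quad\text{for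 all } w_h\in H^1_0(K)\cap\mathbb V_k(K).$$ Write $(\nabla u_h,\nabla v_h)_h=\sum_{K\in\mathcal T_h}(\nabla u_h,\nabla v_h)_K$. Functions are identified when they agree almost everywhere. Then: 1. $\Pi_h^\nabla$ is well defined on $\tilde V_h$ (such a $v_h$ exists and is unique), and $\Pi_h^\nabla\tilde v\in H^1_0(\Omega)$. 2. The bilinear form without stabilizer is coercive on $\tilde V_h$: there is a constant $\alpha>0$ (depending on $\Omega$, $\mathcal T_h$ and $k$) such that $(\nabla\Pi_h^\nabla\tilde v,\nabla\Pi_h^\nabla\tilde v)_h\ge\alpha\,(\nabla\tilde v,\nabla\tilde v)$ for all $\tilde v\in\tilde V_h$. 3. For every $f\in L^2(\Omega)$ the stabilizer-free virtual element equation $$(\nabla u_h,\nabla v_h)_h=(f,v_h)\qquad\text{for all }\tilde v\in\tilde V_h,\ v_h=\Pi_h^\nabla\tilde v,$$ has a unique solution $u_h=\Pi_h^\nabla\tilde u$ with $\tilde u\in\tilde V_h$; both $\tilde u$ and $u_h$ are uniquely determined. -/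

import Mathlib

open MeasureTheory Set Filter Topology
open scoped ContDiff RealInnerProductSpace

noncomputable section

namespace VEM

/-- The Euclidean plane. -/
abbrev Plane : Type := EuclideanSpace ℝ (Fin 2)

/-! ## Sobolev spaces on an open set of the plane -/

/-- `φ ∈ C_c^∞(U)`. -/
structure IsTestFunction (U : Set Plane) (φ : Plane → ℝ) : Prop where
  contDiff : ContDiff ℝ ∞ φ
  hasCompactSupport : HasCompactSupport φ
  tsupport_subset : tsupport φ ⊆ U

/-- `g` is the weak (distributional) gradient of `u` on the open set `U`. -/
structure IsWeakGradient (U : Set Plane) (u : Plane → ℝ) (g : Plane → Plane) : Prop where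
  locallyIntegrableOn : LocallyIntegrableOn u U
  locallyIntegrableOn_grad : LocallyIntegrableOn g U
  integral_eq : ∀ φ : Plane → ℝ, IsTestFunction U φ →
    ∫ x in U, u x • gradient φ x = -∫ x in U, φ x • g x

open Classical in
/-- The weak gradient of `u` on `U` (unique almost everywhere on `U`);
the value is `0` if `u` has no weak gradient on `U`. -/
def weakGrad (U : Set Plane) (u : Plane → ℝ) : Plane → Plane :=
  if h : ∃ g, IsWeakGradient U u g then h.choose else 0

/-- `u ∈ H¹(U)`. -/
structure MemH1 (U : Set Plane) (u : Plane → ℝ) : Prop where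
  memLp : MemLp u 2 (volume.restrict U)
  exists_weakGradient : ∃ g, IsWeakGradient U u g
  memLp_grad : MemLp (weakGrad U u) 2 (volume.restrict U)

/-- `u ∈ H¹₀(U)`, the closure of `C_c^∞(U)` in `H¹(U)`. -/
structure MemH10 (U : Set Plane) (u : Plane → ℝ) : Prop where
  memH1 : MemH1 U u
  exists_approx : ∃ φ : ℕ → Plane → ℝ, (∀ n, IsTestFunction U (φ n)) ∧
    Tendsto (fun n => eLpNorm (fun x => u x - φ n x) 2 (volume.restrict U)) atTop (𝓝 0) ∧
    Tendsto (fun n => eLpNorm (fun x => weakGrad U u x - gradient (φ n) x) 2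
      (volume.restrict U)) atTop (𝓝 0)

/-- The Dirichlet form `(∇u, ∇v)_U`. -/
def dirichlet (U : Set Plane) (u v : Plane → ℝ) : ℝ :=
  ∫ x in U, ⟪weakGrad U u x, weakGrad U v x⟫

/-! ## Polynomials -/

/-- The value at a point of the plane of a real polynomial in two variables. -/
def polyEval (p : MvPolynomial (Fin 2) ℝ) (x : Plane) : ℝ :=
  MvPolynomial.eval (fun i => x i) p

/-- `Δu|_U ∈ P_{k-2}(U)`, with `P_{-1} = {0}`, for `u ∈ H¹(U)`; the Laplacian is the
distributional one, `⟨Δu, φ⟩ = -(∇u, ∇φ)_U` for `φ ∈ C_c^∞(U)`. -/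
def HasPolyLaplacian (k : ℕ) (U : Set Plane) (u : Plane → ℝ) : Prop :=
  ∃ p : MvPolynomial (Fin 2) ℝ, (p = 0 ∨ p.totalDegree + 2 ≤ k) ∧
    ∀ φ : Plane → ℝ, IsTestFunction U φ →
      -∫ x in U, ⟪weakGrad U u x, gradient φ x⟫ = ∫ x in U, polyEval p x * φ x

/-! ## Triangles -/

/-- A nondegenerate triangle in the plane, given by its three vertices. -/
abbrev Triangle : Type := Affine.Triangle ℝ Plane

/-- The closed triangle `K`. -/
def closedTri (T : Triangle) : Set Plane := convexHull ℝ (range T.points)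

/-- The open triangle, the interior of `K`. -/
def openTri (T : Triangle) : Set Plane := interior (closedTri T)

/-- The barycenter of a triangle. -/
def barycenter (T : Triangle) : Plane := (1 / 3 : ℝ) • ∑ i, T.points i

/-- The `i`-th closed subtriangle of the Hsieh–Clough–Tocher split of a triangle: its vertices
are the barycenter and the two vertices other than the `i`-th one. -/
def hctPiece (T : Triangle) (i : Fin 3) : Set Plane :=
  convexHull ℝ {barycenter T, T.points (i + 1), T.points (i + 2)}

/-- `w ∈ 𝕍_k(K)`: continuous on `K`, and a polynomial of degree at most `k` on each piece of the
Hsieh–Clough–Tocher split. -/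
structure MemHCT (k : ℕ) (T : Triangle) (w : Plane → ℝ) : Prop where
  continuousOn : ContinuousOn w (closedTri T)
  poly : ∀ i : Fin 3, ∃ p : MvPolynomial (Fin 2) ℝ, p.totalDegree ≤ k ∧
    ∀ x ∈ hctPiece T i, w x = polyEval p x

/-- `g ∈ 𝔹_k(∂K)`: continuous on `∂K`, and a polynomial of degree at most `k` on each edge. -/
structure MemBoundaryPoly (k : ℕ) (T : Triangle) (g : Plane → ℝ) : Prop where
  continuousOn : ContinuousOn g (frontier (closedTri T))
  poly : ∀ i : Fin 3, ∃ q : Polynomial ℝ, q.natDegree ≤ k ∧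
    ∀ t ∈ Icc (0 : ℝ) 1,
      g (AffineMap.lineMap (T.points (i + 1)) (T.points (i + 2)) t) = q.eval t

/-- The trace on `∂K` of `u ∈ H¹(K)` is the continuous function `g|_{∂K}`: the function `g|_{∂K}`
has an extension `G ∈ H¹(K) ∩ C(K)` with `u - G ∈ H¹₀(K)`. -/
def HasTrace (T : Triangle) (u g : Plane → ℝ) : Prop :=
  ∃ G : Plane → ℝ, ContinuousOn G (closedTri T) ∧ MemH1 (openTri T) G ∧
    EqOn G g (frontier (closedTri T)) ∧ MemH10 (openTri T) (fun x => u x - G x)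

/-! ## The mesh and the virtual element method -/

/-- `𝒯` is a (finite, conforming) triangular mesh on `Ω`: the closed triangles cover the closure
of `Ω`, the open ones are contained in `Ω` and pairwise disjoint, and two triangles meet exactly
in the hull of their common vertices (nothing, a vertex or an edge). -/
structure IsTriangularMesh (Ω : Set Plane) (𝒯 : Finset Triangle) : Prop where
  openTri_subset : ∀ T ∈ 𝒯, openTri T ⊆ Ω
  iUnion_eq : ⋃ T ∈ 𝒯, closedTri T = closure Ω
  disjoint : ∀ T ∈ 𝒯, ∀ T' ∈ 𝒯, T ≠ T' → Disjoint (openTri T) (openTri T')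
  conforming : ∀ T ∈ 𝒯, ∀ T' ∈ 𝒯,
    closedTri T ∩ closedTri T' = convexHull ℝ (range T.points ∩ range T'.points)

/-- The virtual element space `Ṽ_h`. -/
structure MemVirtual (k : ℕ) (Ω : Set Plane) (𝒯 : Finset Triangle) (v : Plane → ℝ) : Prop where
  memH10 : MemH10 Ω v
  trace : ∀ T ∈ 𝒯, ∃ g, MemBoundaryPoly k T g ∧ HasTrace T v g
  laplacian : ∀ T ∈ 𝒯, HasPolyLaplacian k (openTri T) v

/-- `w ∈ 𝕍_k(K)` is the local interpolant of `v` on the triangle `K`: `w = v` on `∂K`, and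
`(∇w, ∇z)_K = (∇v, ∇z)_K` for all `z ∈ H¹₀(K) ∩ 𝕍_k(K)`. -/
structure IsLocalInterpolant (k : ℕ) (T : Triangle) (v w : Plane → ℝ) : Prop where
  memHCT : MemHCT k T w
  trace : HasTrace T v w
  dirichlet_eq : ∀ z : Plane → ℝ, MemHCT k T z → MemH10 (openTri T) z →
    dirichlet (openTri T) w z = dirichlet (openTri T) v z

/-- `v_h = Π_h^∇ v`: on each triangle `v_h` is the local interpolant of `v`. As an element of
`L²(Ω)`, `v_h` is only determined almost everywhere, so nothing is said on the (null) edges. -/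
def IsInterpolant (k : ℕ) (𝒯 : Finset Triangle) (v vh : Plane → ℝ) : Prop :=
  ∀ T ∈ 𝒯, ∃ w, IsLocalInterpolant k T v w ∧ EqOn vh w (openTri T)

/-- The broken Dirichlet form `(∇u_h, ∇v_h)_h = ∑_K (∇u_h, ∇v_h)_K`. -/
def brokenDirichlet (𝒯 : Finset Triangle) (uh vh : Plane → ℝ) : ℝ :=
  ∑ T ∈ 𝒯, dirichlet (openTri T) uh vh

/-- `u_h = Π_h^∇ u`, with `u ∈ Ṽ_h`, solves the stabilizer-free virtual element equation
`(∇u_h, ∇v_h)_h = (f, v_h)` for all `v ∈ Ṽ_h`, `v_h = Π_h^∇ v`. -/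
structure IsVEMSolution (k : ℕ) (Ω : Set Plane) (𝒯 : Finset Triangle) (f u uh : Plane → ℝ) :
    Prop where
  memVirtual : MemVirtual k Ω 𝒯 u
  isInterpolant : IsInterpolant k 𝒯 u uh
  eq : ∀ v vh : Plane → ℝ, MemVirtual k Ω 𝒯 v → IsInterpolant k 𝒯 v vh →
    brokenDirichlet 𝒯 uh vh = ∫ x in Ω, f x * vh x

end VEM

end

namespace VEM

variable {U V : Set Plane} {u v : Plane → ℝ} {g h : Plane → Plane} {φ : Plane → ℝ}

/-! ## Test functions -/

/-! Everything rests on an estimate on one triangle K: if Δv = p is a polynomial of degree at most k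
- 2 and w is the local interpolant of v, then ‖∇v‖ ≤ C‖∇w‖
(`exists_dirichlet_le_mul_dirichlet_interpolant`). Let b = min λ_i be the least barycentric
coordinate. It is positive inside K, vanishes on ∂K and is linear on each piece of the split, so b²p
lies in H¹₀(K) ∩ 𝕍_k(K) and is an admissible test function for w. Thus (∇w, ∇(b²p)) = (∇v, ∇(b²p)) =
-‖bp‖². On the finite-dimensional space of such p, both ‖∇(b²p)‖ and ‖p‖ are controlled by ‖bp‖, so
‖p‖ ≤ C‖∇w‖. The remainder r = v - w is in H¹₀(K), hence ‖∇r‖² = -(p, r) - (∇w, ∇r), and the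
Poincaré inequality bounds ‖∇r‖ by ‖∇w‖. This is where the split matters: the cubic bubble λ₁λ₂λ₃
would raise the degree of p by 3, whereas b² raises it by 2 only.

The interpolant exists locally because piecewise polynomial boundary data extend to 𝕍_k(K)
(`MemBoundaryPoly.exists_memHCT`) and the extension is corrected by the solution of a
finite-dimensional variational problem (`exists_mem_inner_eq`). It is globally in H¹₀(Ω) because it
differs from v by a sum of zero extensions of functions in H¹₀(K). Summing the local estimates gives
coercivity.

The discrete equation is solved by the Riesz theorem on the finite-dimensional space of gradients of
interpolants. The load factors through these gradients since, by Poincaré, a function in H¹₀(Ω) with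
zero gradient vanishes. Uniqueness of u_h is again Poincaré; that of u is coercivity followed by
Poincaré.

The analytic groundwork treats H¹₀ as the closure of the pairs (φ, ∇φ) in L² × L². Its main result
is that an H¹ function continuous up to the boundary and zero there lies in H¹₀
(`MemH1.memH10_of_eqOn_frontier`), which turns pointwise boundary values into statements about
traces. -/

theorem IsTestFunction.mono (hφ : IsTestFunction U φ) (hUV : U ⊆ V) : IsTestFunction V φ :=
  ⟨hφ.contDiff, hφ.hasCompactSupport, hφ.tsupport_subset.trans hUV⟩

theorem inner_gradient (φ : Plane → ℝ) (x e : Plane) : ⟪gradient φ x, e⟫ = fderiv ℝ φ x e :=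
  inner_gradient_left

theorem continuous_gradient (hφ : ContDiff ℝ 1 φ) : Continuous (gradient φ) :=
  (InnerProductSpace.toDual ℝ Plane).symm.continuous.comp (hφ.continuous_fderiv one_ne_zero)

theorem norm_gradient (φ : Plane → ℝ) (x : Plane) : ‖gradient φ x‖ = ‖fderiv ℝ φ x‖ := by
  simp [gradient]

theorem gradient_eq_zero_of_notMem_tsupport {x : Plane} (hx : x ∉ tsupport φ) :
    gradient φ x = 0 := by
  have : fderiv ℝ φ x = 0 := image_eq_zero_of_notMem_tsupport
    (fun h => hx (tsupport_fderiv_subset ℝ h))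
  simp [gradient, this]

theorem IsTestFunction.contDiff_one (hφ : IsTestFunction U φ) : ContDiff ℝ 1 φ :=
  hφ.contDiff.of_le (by exact_mod_cast le_top)

theorem IsTestFunction.differentiable (hφ : IsTestFunction U φ) : Differentiable ℝ φ :=
  hφ.contDiff_one.differentiable one_ne_zero

theorem IsTestFunction.continuous_gradient (hφ : IsTestFunction U φ) : Continuous (gradient φ) :=
  VEM.continuous_gradient hφ.contDiff_one

theorem HasCompactSupport.gradient (hφ : HasCompactSupport φ) :
    HasCompactSupport (gradient φ) :=
  HasCompactSupport.intro hφ fun _ hx => gradient_eq_zero_of_notMem_tsupport hx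

theorem IsTestFunction.eq_zero (hφ : IsTestFunction U φ) {x : Plane} (hx : x ∉ U) : φ x = 0 :=
  image_eq_zero_of_notMem_tsupport fun h => hx (hφ.tsupport_subset h)

theorem IsTestFunction.gradient_eq_zero (hφ : IsTestFunction U φ) {x : Plane} (hx : x ∉ U) :
    gradient φ x = 0 :=
  gradient_eq_zero_of_notMem_tsupport fun h => hx (hφ.tsupport_subset h)

theorem IsTestFunction.memLp (hφ : IsTestFunction U φ) (μ : Measure Plane)
    [IsFiniteMeasureOnCompacts μ] (p : ENNReal) : MemLp φ p μ :=
  hφ.contDiff.continuous.memLp_of_hasCompactSupport hφ.hasCompactSupport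

theorem IsTestFunction.memLp_gradient (hφ : IsTestFunction U φ) (μ : Measure Plane)
    [IsFiniteMeasureOnCompacts μ] (p : ENNReal) : MemLp (gradient φ) p μ :=
  hφ.continuous_gradient.memLp_of_hasCompactSupport (HasCompactSupport.gradient hφ.hasCompactSupport)

theorem IsTestFunction.zero : IsTestFunction U (fun _ => 0) :=
  ⟨contDiff_const, HasCompactSupport.zero, by
    have : tsupport (fun _ : Plane => (0 : ℝ)) = ∅ := by simp
    simp [this]⟩

theorem gradient_add' {φ ψ : Plane → ℝ} (hφ : Differentiable ℝ φ) (hψ : Differentiable ℝ ψ)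
    (x : Plane) : gradient (fun x => φ x + ψ x) x = gradient φ x + gradient ψ x := by
  simp [gradient, fderiv_fun_add (hφ x) (hψ x)]

theorem gradient_const_mul' (c : ℝ) (hφ : Differentiable ℝ φ) (x : Plane) :
    gradient (fun x => c * φ x) x = c • gradient φ x := by
  simp [gradient, fderiv_const_mul (hφ x) c]

theorem gradient_mul' {φ ψ : Plane → ℝ} {x : Plane} (hφ : DifferentiableAt ℝ φ x)
    (hψ : DifferentiableAt ℝ ψ x) :
    gradient (fun x => φ x * ψ x) x = φ x • gradient ψ x + ψ x • gradient φ x := by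
  simp [gradient, fderiv_fun_mul hφ hψ]

theorem IsTestFunction.add {ψ : Plane → ℝ} (hφ : IsTestFunction U φ) (hψ : IsTestFunction U ψ) :
    IsTestFunction U (fun x => φ x + ψ x) :=
  ⟨hφ.contDiff.add hψ.contDiff, hφ.hasCompactSupport.add hψ.hasCompactSupport,
    (tsupport_add φ ψ).trans (union_subset hφ.tsupport_subset hψ.tsupport_subset)⟩

theorem IsTestFunction.smooth_mul {ψ : Plane → ℝ} (hφ : IsTestFunction U φ)
    (hψ : ContDiff ℝ ∞ ψ) : IsTestFunction U (fun x => φ x * ψ x) :=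
  ⟨hφ.contDiff.mul hψ, hφ.hasCompactSupport.mul_right,
    (tsupport_mul_subset_left (f := φ) (g := ψ)).trans hφ.tsupport_subset⟩

theorem IsTestFunction.const_mul (c : ℝ) (hφ : IsTestFunction U φ) :
    IsTestFunction U (fun x => c * φ x) := by
  simpa only [mul_comm] using hφ.smooth_mul (contDiff_const (c := c))

/-! ## Functions with a square integrable weak gradient -/

/-- `u ∈ L²(U)` has the weak gradient `g ∈ L²(U)`. -/
structure IsH1Pair (U : Set Plane) (u : Plane → ℝ) (g : Plane → Plane) : Prop where
  memLp : MemLp u 2 (volume.restrict U)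
  memLp_grad : MemLp g 2 (volume.restrict U)
  integral_eq : ∀ φ : Plane → ℝ, IsTestFunction U φ → ∀ e : Plane,
    ∫ x in U, u x * ⟪gradient φ x, e⟫ = -∫ x in U, φ x * ⟪g x, e⟫

theorem MemLp.locallyIntegrableOn {F : Type*} [NormedAddCommGroup F] {f : Plane → F}
    (hf : MemLp f 2 (volume.restrict U)) : LocallyIntegrableOn f U :=
  locallyIntegrableOn_of_locallyIntegrable_restrict (hf.locallyIntegrable (by norm_num))

theorem integrable_smul_of_memLp_two {X F : Type*} [MeasurableSpace X] [NormedAddCommGroup F]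
    [NormedSpace ℝ F] {μ : Measure X} {a : X → ℝ} {f : X → F} (ha : MemLp a 2 μ) (hf : MemLp f 2 μ) :
    Integrable (fun x => a x • f x) μ :=
  memLp_one_iff_integrable.1 (hf.smul ha)

theorem integrable_mul_of_memLp_two {X : Type*} [MeasurableSpace X] {μ : Measure X}
    {a f : X → ℝ} (ha : MemLp a 2 μ)
    (hf : MemLp f 2 μ) : Integrable (fun x => a x * f x) μ :=
  integrable_smul_of_memLp_two ha hf

theorem integrable_inner_of_memLp_two {X F : Type*} [MeasurableSpace X] [NormedAddCommGroup F]
    [InnerProductSpace ℝ F] {μ : Measure X} {f g : X → F} (hf : MemLp f 2 μ)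
    (hg : MemLp g 2 μ) : Integrable (fun x => ⟪f x, g x⟫) μ :=
  (L2.integrable_inner (𝕜 := ℝ) hf.toLp hg.toLp).congr <| by
    filter_upwards [hf.coeFn_toLp, hg.coeFn_toLp] with x h1 h2
    rw [h1, h2]

/-- A vector identity can be tested against each direction e, and the inner product with e passes
through the integrals because both integrands are integrable. Local integrability is automatic for
L² functions. -/
theorem isWeakGradient_iff_of_memLp (hu : MemLp u 2 (volume.restrict U))
    (hg : MemLp g 2 (volume.restrict U)) : IsWeakGradient U u g ↔ IsH1Pair U u g := by
  have key : ∀ φ : Plane → ℝ, IsTestFunction U φ →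
      ((∫ x in U, u x • gradient φ x = -∫ x in U, φ x • g x) ↔
        ∀ e : Plane, ∫ x in U, u x * ⟪gradient φ x, e⟫ = -∫ x in U, φ x * ⟪g x, e⟫) := by
    intro φ hφ
    have i1 := integrable_smul_of_memLp_two hu (hφ.memLp_gradient (volume.restrict U) 2)
    have i2 := integrable_smul_of_memLp_two (hφ.memLp (volume.restrict U) 2) hg
    have e1 : ∀ e, ⟪e, ∫ x in U, u x • gradient φ x⟫ = ∫ x in U, u x * ⟪gradient φ x, e⟫ := by
      intro e
      rw [← integral_inner i1]
      simp [inner_smul_right, real_inner_comm e]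
    have e2 : ∀ e, ⟪e, -∫ x in U, φ x • g x⟫ = -∫ x in U, φ x * ⟪g x, e⟫ := by
      intro e
      rw [inner_neg_right, ← integral_inner i2]
      simp [inner_smul_right, real_inner_comm e]
    constructor
    · intro h e
      rw [← e1, h, e2]
    · intro h
      refine ext_inner_left ℝ fun e => ?_
      rw [e1, e2, h]
  constructor
  · intro h
    exact ⟨hu, hg, fun φ hφ => (key φ hφ).1 (h.integral_eq φ hφ)⟩
  · intro h
    exact ⟨MemLp.locallyIntegrableOn hu, MemLp.locallyIntegrableOn hg,
      fun φ hφ => (key φ hφ).2 (h.integral_eq φ hφ)⟩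

/-- The difference of two weak gradients is orthogonal to all test functions, so the fundamental
lemma of the calculus of variations applies. This makes the choice hidden in `weakGrad` harmless. -/
theorem IsWeakGradient.ae_eq (hU : IsOpen U) (hg : IsWeakGradient U u g)
    (hh : IsWeakGradient U u h) : g =ᵐ[volume.restrict U] h := by
  have hint : ∀ {f : Plane → Plane}, LocallyIntegrableOn f U → ∀ φ, IsTestFunction U φ →
      Integrable (fun x => φ x • f x) (volume.restrict U) := by
    intro f hf φ hφ
    have h1 : IntegrableOn f (tsupport φ) :=
      hf.integrableOn_compact_subset hφ.tsupport_subset hφ.hasCompactSupport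
    have h2 : IntegrableOn (fun x => φ x • f x) (tsupport φ) :=
      h1.continuousOn_smul hφ.contDiff.continuous.continuousOn hφ.hasCompactSupport
    have h3 : Integrable (fun x => φ x • f x) volume := by
      refine (integrableOn_iff_integrable_of_support_subset ?_).1 h2
      exact (Function.support_smul_subset_left φ f).trans (subset_tsupport φ)
    exact h3.integrableOn
  have := hU.ae_eq_zero_of_integral_contDiff_smul_eq_zero
    (hg.locallyIntegrableOn_grad.sub hh.locallyIntegrableOn_grad) (fun φ h1 h2 h3 => by
      have hφ : IsTestFunction U φ := ⟨h1, h2, h3⟩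
      rw [← setIntegral_eq_integral_of_forall_compl_eq_zero (s := U)
        (fun x hx => by rw [hφ.eq_zero hx, zero_smul])]
      simp only [Pi.sub_apply, smul_sub]
      rw [integral_sub (hint hg.locallyIntegrableOn_grad φ hφ)
        (hint hh.locallyIntegrableOn_grad φ hφ), sub_eq_zero]
      have h4 := hg.integral_eq φ hφ
      rw [hh.integral_eq φ hφ] at h4
      exact (neg_injective h4).symm)
  rw [EventuallyEq, ae_restrict_iff' hU.measurableSet]
  filter_upwards [this] with x hx hxU
  exact sub_eq_zero.1 (hx hxU)

theorem MemH1.isH1Pair (hu : MemH1 U u) : IsH1Pair U u (weakGrad U u) := by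
  refine (isWeakGradient_iff_of_memLp hu.memLp hu.memLp_grad).1 ?_
  have := hu.exists_weakGradient
  rw [weakGrad, dif_pos this]
  exact this.choose_spec

theorem IsH1Pair.isWeakGradient (hu : IsH1Pair U u g) : IsWeakGradient U u g :=
  (isWeakGradient_iff_of_memLp hu.memLp hu.memLp_grad).2 hu

theorem IsH1Pair.weakGrad_ae_eq (hU : IsOpen U) (hu : IsH1Pair U u g) :
    weakGrad U u =ᵐ[volume.restrict U] g := by
  have : ∃ g, IsWeakGradient U u g := ⟨g, hu.isWeakGradient⟩
  rw [weakGrad, dif_pos this]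
  exact this.choose_spec.ae_eq hU hu.isWeakGradient

theorem IsH1Pair.memH1 (hU : IsOpen U) (hu : IsH1Pair U u g) : MemH1 U u :=
  ⟨hu.memLp, ⟨g, hu.isWeakGradient⟩, hu.memLp_grad.ae_eq (hu.weakGrad_ae_eq hU).symm⟩

theorem IsH1Pair.congr (hu : IsH1Pair U u g) (huv : u =ᵐ[volume.restrict U] v)
    (hgh : g =ᵐ[volume.restrict U] h) : IsH1Pair U v h := by
  refine ⟨hu.memLp.ae_eq huv, hu.memLp_grad.ae_eq hgh, fun φ hφ e => ?_⟩
  have h1 : ∫ x in U, v x * ⟪gradient φ x, e⟫ = ∫ x in U, u x * ⟪gradient φ x, e⟫ :=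
    integral_congr_ae (by filter_upwards [huv] with x hx; rw [hx])
  have h2 : ∫ x in U, φ x * ⟪h x, e⟫ = ∫ x in U, φ x * ⟪g x, e⟫ :=
    integral_congr_ae (by filter_upwards [hgh] with x hx; rw [hx])
  rw [h1, h2, hu.integral_eq φ hφ e]

theorem MemLp.inner_const_two {X : Type*} [MeasurableSpace X] {μ : Measure X}
    {g : X → Plane} (hg : MemLp g 2 μ) (e : Plane) :
    MemLp (fun x => ⟪g x, e⟫) 2 μ := hg.inner_const (𝕜 := ℝ) e

theorem IsH1Pair.add (hu : IsH1Pair U u g) (hv : IsH1Pair U v h) :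
    IsH1Pair U (fun x => u x + v x) (fun x => g x + h x) := by
  refine ⟨hu.memLp.add hv.memLp, hu.memLp_grad.add hv.memLp_grad, fun φ hφ e => ?_⟩
  have hφe := MemLp.inner_const_two (hφ.memLp_gradient (volume.restrict U) 2) e
  have hφ2 := hφ.memLp (volume.restrict U) 2
  simp only [inner_add_left, add_mul, mul_add]
  rw [integral_add (integrable_mul_of_memLp_two hu.memLp hφe)
      (integrable_mul_of_memLp_two hv.memLp hφe),
    integral_add (integrable_mul_of_memLp_two hφ2 (MemLp.inner_const_two hu.memLp_grad e))
      (integrable_mul_of_memLp_two hφ2 (MemLp.inner_const_two hv.memLp_grad e)),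
    hu.integral_eq φ hφ e, hv.integral_eq φ hφ e]
  ring

theorem IsH1Pair.const_mul (c : ℝ) (hu : IsH1Pair U u g) :
    IsH1Pair U (fun x => c * u x) (fun x => c • g x) := by
  refine ⟨hu.memLp.const_mul c, hu.memLp_grad.const_smul c, fun φ hφ e => ?_⟩
  simp only [inner_smul_left, mul_assoc, RCLike.conj_to_real, mul_left_comm _ c]
  rw [integral_const_mul, integral_const_mul, hu.integral_eq φ hφ e]
  ring

theorem IsH1Pair.mono (hVU : V ⊆ U) (hu : IsH1Pair U u g) : IsH1Pair V u g := by
  have hm : volume.restrict V ≤ volume.restrict U := Measure.restrict_mono hVU le_rfl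
  refine ⟨hu.memLp.mono_measure hm, hu.memLp_grad.mono_measure hm, fun φ hφ e => ?_⟩
  have := hu.integral_eq φ (hφ.mono hVU) e
  rw [setIntegral_eq_integral_of_forall_compl_eq_zero (fun x hx => by
      rw [hφ.gradient_eq_zero (fun h => hx (hVU h)), inner_zero_left, mul_zero]),
    setIntegral_eq_integral_of_forall_compl_eq_zero (fun x hx => by
      rw [hφ.eq_zero (fun h => hx (hVU h)), zero_mul])] at this
  rw [setIntegral_eq_integral_of_forall_compl_eq_zero (fun x hx => by
      rw [hφ.gradient_eq_zero hx, inner_zero_left, mul_zero]),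
    setIntegral_eq_integral_of_forall_compl_eq_zero (fun x hx => by
      rw [hφ.eq_zero hx, zero_mul])]
  exact this

theorem IsTestFunction.isH1Pair (hφ : IsTestFunction U φ) : IsH1Pair U φ (gradient φ) := by
  refine ⟨hφ.memLp _ 2, hφ.memLp_gradient _ 2, fun ψ hψ e => ?_⟩
  rw [setIntegral_eq_integral_of_forall_compl_eq_zero (fun x hx => by
      rw [hψ.gradient_eq_zero hx, inner_zero_left, mul_zero]),
    setIntegral_eq_integral_of_forall_compl_eq_zero (fun x hx => by
      rw [hψ.eq_zero hx, zero_mul])]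
  simp only [inner_gradient]
  have a1 := hφ.memLp volume 2
  have a2 := hψ.memLp volume 2
  have b1 := MemLp.inner_const_two (hφ.memLp_gradient volume 2) e
  have b2 := MemLp.inner_const_two (hψ.memLp_gradient volume 2) e
  simp only [inner_gradient] at b1 b2
  rw [integral_mul_fderiv_eq_neg_fderiv_mul_of_integrable (integrable_mul_of_memLp_two b1 a2)
    (integrable_mul_of_memLp_two a1 b2) (integrable_mul_of_memLp_two a1 a2)
    (fun x _ => hφ.differentiable x) (fun x _ => hψ.differentiable x)]
  simp only [mul_comm]

theorem MemH1.weakGrad_congr (hU : IsOpen U) (hu : MemH1 U u) (huv : u =ᵐ[volume.restrict U] v) :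
    weakGrad U v =ᵐ[volume.restrict U] weakGrad U u :=
  (hu.isH1Pair.congr huv (ae_eq_refl _)).weakGrad_ae_eq hU

theorem MemH1.add (hU : IsOpen U) (hu : MemH1 U u) (hv : MemH1 U v) :
    MemH1 U (fun x => u x + v x) :=
  (hu.isH1Pair.add hv.isH1Pair).memH1 hU

theorem MemH1.weakGrad_add (hU : IsOpen U) (hu : MemH1 U u) (hv : MemH1 U v) :
    weakGrad U (fun x => u x + v x) =ᵐ[volume.restrict U]
      fun x => weakGrad U u x + weakGrad U v x :=
  (hu.isH1Pair.add hv.isH1Pair).weakGrad_ae_eq hU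

theorem MemH1.const_mul (hU : IsOpen U) (c : ℝ) (hu : MemH1 U u) : MemH1 U (fun x => c * u x) :=
  (hu.isH1Pair.const_mul c).memH1 hU

theorem MemH1.weakGrad_const_mul (hU : IsOpen U) (c : ℝ) (hu : MemH1 U u) :
    weakGrad U (fun x => c * u x) =ᵐ[volume.restrict U] fun x => c • weakGrad U u x :=
  (hu.isH1Pair.const_mul c).weakGrad_ae_eq hU

theorem MemH1.mono (hV : IsOpen V) (hVU : V ⊆ U) (hu : MemH1 U u) : MemH1 V u :=
  (hu.isH1Pair.mono hVU).memH1 hV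

theorem MemH1.weakGrad_mono (hV : IsOpen V) (hVU : V ⊆ U) (hu : MemH1 U u) :
    weakGrad V u =ᵐ[volume.restrict V] weakGrad U u :=
  (hu.isH1Pair.mono hVU).weakGrad_ae_eq hV

end VEM

noncomputable section

namespace VEM

variable {U V : Set Plane} {u v : Plane → ℝ} {g h : Plane → Plane} {φ : Plane → ℝ}

/-! ## The closure of the test functions in `H¹` -/

/-- The pairs `(φ, ∇φ)`, `φ ∈ C_c^∞(U)`, in `L² × L²`. -/
def testGraph (U : Set Plane) :
    Submodule ℝ (Lp ℝ 2 (volume.restrict U) × Lp Plane 2 (volume.restrict U)) where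
  carrier := {p | ∃ φ, IsTestFunction U φ ∧ p.1 =ᵐ[volume.restrict U] φ ∧
    p.2 =ᵐ[volume.restrict U] gradient φ}
  add_mem' := by
    rintro p q ⟨φ, hφ, h1, h2⟩ ⟨ψ, hψ, h3, h4⟩
    refine ⟨_, hφ.add hψ, ?_, ?_⟩
    · filter_upwards [Lp.coeFn_add p.1 q.1, h1, h3] with x a b c
      rw [Prod.fst_add, a, Pi.add_apply, b, c]
    · filter_upwards [Lp.coeFn_add p.2 q.2, h2, h4] with x a b c
      rw [Prod.snd_add, a, Pi.add_apply, b, c, gradient_add' hφ.differentiable hψ.differentiable]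
  zero_mem' := by
    refine ⟨_, IsTestFunction.zero, Lp.coeFn_zero _ _ _, ?_⟩
    filter_upwards [Lp.coeFn_zero Plane 2 (volume.restrict U)] with x hx
    simpa using hx
  smul_mem' := by
    rintro c p ⟨φ, hφ, h1, h2⟩
    refine ⟨_, hφ.const_mul c, ?_, ?_⟩
    · filter_upwards [Lp.coeFn_smul c p.1, h1] with x a b
      rw [Prod.smul_fst, a, Pi.smul_apply, b, smul_eq_mul]
    · filter_upwards [Lp.coeFn_smul c p.2, h2] with x a b
      rw [Prod.smul_snd, a, Pi.smul_apply, b, gradient_const_mul' c hφ.differentiable]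

/-- `(u, g)` is a limit in `L² × L²` of pairs `(φ, ∇φ)`, `φ ∈ C_c^∞(U)`. -/
def IsH10Pair (U : Set Plane) (u : Plane → ℝ) (g : Plane → Plane) : Prop :=
  ∃ (hu : MemLp u 2 (volume.restrict U)) (hg : MemLp g 2 (volume.restrict U)),
    (hu.toLp, hg.toLp) ∈ (testGraph U).topologicalClosure

theorem IsTestFunction.isH10Pair (hφ : IsTestFunction U φ) : IsH10Pair U φ (gradient φ) :=
  ⟨hφ.memLp _ 2, hφ.memLp_gradient _ 2, Submodule.le_topologicalClosure _
    ⟨φ, hφ, (hφ.memLp _ 2).coeFn_toLp, (hφ.memLp_gradient _ 2).coeFn_toLp⟩⟩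

theorem IsH10Pair.memLp (h : IsH10Pair U u g) : MemLp u 2 (volume.restrict U) := h.1

theorem IsH10Pair.memLp_grad (h : IsH10Pair U u g) : MemLp g 2 (volume.restrict U) := h.2.1

theorem IsH10Pair.congr (hu : IsH10Pair U u g) (huv : u =ᵐ[volume.restrict U] v)
    (hgh : g =ᵐ[volume.restrict U] h) : IsH10Pair U v h := by
  obtain ⟨h1, h2, h3⟩ := hu
  refine ⟨h1.ae_eq huv, h2.ae_eq hgh, ?_⟩
  rwa [← MemLp.toLp_congr h1 _ huv, ← MemLp.toLp_congr h2 _ hgh]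

theorem IsH10Pair.add (hu : IsH10Pair U u g) (hv : IsH10Pair U v h) :
    IsH10Pair U (fun x => u x + v x) (fun x => g x + h x) := by
  obtain ⟨h1, h2, h3⟩ := hu
  obtain ⟨h4, h5, h6⟩ := hv
  exact ⟨h1.add h4, h2.add h5, Submodule.add_mem _ h3 h6⟩

theorem IsH10Pair.const_mul (c : ℝ) (hu : IsH10Pair U u g) :
    IsH10Pair U (fun x => c * u x) (fun x => c • g x) := by
  obtain ⟨h1, h2, h3⟩ := hu
  exact ⟨h1.const_smul c, h2.const_smul c, Submodule.smul_mem _ c h3⟩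

theorem IsH10Pair.sub (hu : IsH10Pair U u g) (hv : IsH10Pair U v h) :
    IsH10Pair U (fun x => u x - v x) (fun x => g x - h x) := by
  simpa [sub_eq_add_neg] using hu.add (hv.const_mul (-1))

theorem IsH10Pair.zero : IsH10Pair U (fun _ => 0) (fun _ => 0) := by
  simpa using (IsTestFunction.zero (U := U)).isH10Pair

/-- Since the pairs form a closed subspace, approximants may themselves be mere limits of test
functions; no diagonal sequence is needed. -/
theorem IsH10Pair.of_tendsto {un : ℕ → Plane → ℝ} {gn : ℕ → Plane → Plane}
    (hn : ∀ n, IsH10Pair U (un n) (gn n)) (hu : MemLp u 2 (volume.restrict U))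
    (hg : MemLp g 2 (volume.restrict U))
    (h1 : Tendsto (fun n => eLpNorm (un n - u) 2 (volume.restrict U)) atTop (𝓝 0))
    (h2 : Tendsto (fun n => eLpNorm (gn n - g) 2 (volume.restrict U)) atTop (𝓝 0)) :
    IsH10Pair U u g := by
  refine ⟨hu, hg, ?_⟩
  have t1 := (Lp.tendsto_Lp_iff_tendsto_eLpNorm'' un (fun n => (hn n).memLp) u hu).2 h1
  have t2 := (Lp.tendsto_Lp_iff_tendsto_eLpNorm'' gn (fun n => (hn n).memLp_grad) g hg).2 h2
  exact (testGraph U).isClosed_topologicalClosure.mem_of_tendsto (t1.prodMk_nhds t2)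
    (Eventually.of_forall fun n => (hn n).2.2)

theorem IsH10Pair.exists_approx (hu : IsH10Pair U u g) :
    ∃ φ : ℕ → Plane → ℝ, (∀ n, IsTestFunction U (φ n)) ∧
    Tendsto (fun n => eLpNorm (fun x => u x - φ n x) 2 (volume.restrict U)) atTop (𝓝 0) ∧
    Tendsto (fun n => eLpNorm (fun x => g x - gradient (φ n) x) 2
      (volume.restrict U)) atTop (𝓝 0) := by
  obtain ⟨h1, h2, h3⟩ := hu
  rw [← SetLike.mem_coe, Submodule.topologicalClosure_coe, mem_closure_iff_seq_limit] at h3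
  obtain ⟨p, hp, hlim⟩ := h3
  choose φ hφ hφ1 hφ2 using hp
  refine ⟨φ, hφ, ?_, ?_⟩
  · have := (Lp.tendsto_Lp_iff_tendsto_eLpNorm' _ _).1 ((continuous_fst.tendsto _).comp hlim)
    refine this.congr fun n => ?_
    rw [eLpNorm_sub_comm]
    refine eLpNorm_congr_ae ?_
    filter_upwards [hφ1 n, h1.coeFn_toLp] with x a b
    simp only [Pi.sub_apply, Function.comp]
    rw [a, b]
  · have := (Lp.tendsto_Lp_iff_tendsto_eLpNorm' _ _).1 ((continuous_snd.tendsto _).comp hlim)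
    refine this.congr fun n => ?_
    rw [eLpNorm_sub_comm]
    refine eLpNorm_congr_ae ?_
    filter_upwards [hφ2 n, h2.coeFn_toLp] with x a b
    simp only [Pi.sub_apply, Function.comp]
    rw [a, b]

theorem real_inner_eq_mul (a b : ℝ) : ⟪a, b⟫ = a * b := by
  simp [mul_comm]

theorem inner_toLp {X F : Type*} [MeasurableSpace X] [NormedAddCommGroup F]
    [InnerProductSpace ℝ F] {μ : Measure X} {a b : X → F} (ha : MemLp a 2 μ) (hb : MemLp b 2 μ) :
    ⟪ha.toLp, hb.toLp⟫ = ∫ x, ⟪a x, b x⟫ ∂μ := by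
  rw [L2.inner_def]
  refine integral_congr_ae ?_
  filter_upwards [ha.coeFn_toLp, hb.coeFn_toLp] with x h1 h2
  rw [h1, h2]

/-- A continuous linear functional that vanishes at all `(φ, ∇φ)` vanishes on their closure. -/
theorem IsH10Pair.integral_eq_zero {a : Plane → Plane} {b : Plane → ℝ}
    (ha : MemLp a 2 (volume.restrict U)) (hb : MemLp b 2 (volume.restrict U))
    (hab : ∀ φ, IsTestFunction U φ →
      (∫ x in U, ⟪a x, gradient φ x⟫) + ∫ x in U, b x * φ x = 0)
    (hu : IsH10Pair U u g) : (∫ x in U, ⟪a x, g x⟫) + ∫ x in U, b x * u x = 0 := by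
  obtain ⟨h1, h2, h3⟩ := hu
  have key : ((testGraph U).topologicalClosure :
      Set (Lp ℝ 2 (volume.restrict U) × Lp Plane 2 (volume.restrict U))) ⊆
      {p | ⟪ha.toLp, p.2⟫ + ⟪hb.toLp, p.1⟫ = 0} := by
    rw [Submodule.topologicalClosure_coe]
    refine closure_minimal ?_ (isClosed_eq (by fun_prop) continuous_const)
    rintro ⟨p, q⟩ ⟨φ, hφ, h4, h5⟩
    have e1 : p = (hφ.memLp _ 2).toLp := Lp.ext (h4.trans (MemLp.coeFn_toLp _).symm)
    have e2 : q = (hφ.memLp_gradient _ 2).toLp := Lp.ext (h5.trans (MemLp.coeFn_toLp _).symm)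
    rw [mem_ofPred_eq, e1, e2, inner_toLp, inner_toLp, ← hab φ hφ]
    simp only [real_inner_eq_mul]
  have := key h3
  rw [mem_ofPred_eq, inner_toLp, inner_toLp] at this
  simpa only [real_inner_eq_mul] using this

/-- For fixed φ and e, the defect in the integration by parts formula is a continuous linear
functional of (u, g). It vanishes at every pair (ψ, ∇ψ), hence on the closure. -/
theorem IsH10Pair.isH1Pair (hu : IsH10Pair U u g) : IsH1Pair U u g := by
  refine ⟨hu.memLp, hu.memLp_grad, fun φ hφ e => ?_⟩
  have := hu.integral_eq_zero (a := fun x => φ x • e) (b := fun x => ⟪gradient φ x, e⟫)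
    ((ContinuousLinearMap.toSpanSingleton ℝ e).comp_memLp' (hφ.memLp (volume.restrict U) 2))
    (MemLp.inner_const_two (hφ.memLp_gradient _ 2) e) (fun ψ hψ => by
      have := hψ.isH1Pair.integral_eq φ hφ e
      simp only [inner_smul_left, RCLike.conj_to_real, real_inner_comm _ e]
      simp only [mul_comm (ψ _)] at this
      rw [this]
      ring)
  simp only [inner_smul_left, RCLike.conj_to_real, real_inner_comm _ e] at this
  simp only [mul_comm (u _)]
  linarith

/-- A limit of gradients is automatically the weak gradient of the limit, so any candidate g may
serve as a witness. -/
theorem memH10_iff (hU : IsOpen U) : MemH10 U u ↔ ∃ g, IsH10Pair U u g := by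
  constructor
  · rintro ⟨h1, φ, hφ, h2, h3⟩
    refine ⟨weakGrad U u, IsH10Pair.of_tendsto (fun n => (hφ n).isH10Pair) h1.memLp
      h1.memLp_grad ?_ ?_⟩
    · refine h2.congr fun n => ?_
      rw [eLpNorm_sub_comm]; rfl
    · refine h3.congr fun n => ?_
      rw [eLpNorm_sub_comm]; rfl
  · rintro ⟨g, hg⟩
    have hg' := hg.congr (ae_eq_refl _) (hg.isH1Pair.weakGrad_ae_eq hU).symm
    exact ⟨hg.isH1Pair.memH1 hU, hg'.exists_approx⟩

theorem MemH10.isH10Pair (hU : IsOpen U) (hu : MemH10 U u) : IsH10Pair U u (weakGrad U u) := by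
  obtain ⟨g, hg⟩ := (memH10_iff hU).1 hu
  exact hg.congr (ae_eq_refl _) (hg.isH1Pair.weakGrad_ae_eq hU).symm

theorem IsH10Pair.memH10 (hU : IsOpen U) (hu : IsH10Pair U u g) : MemH10 U u :=
  (memH10_iff hU).2 ⟨g, hu⟩

theorem MemH10.congr (hU : IsOpen U) (hu : MemH10 U u) (huv : u =ᵐ[volume.restrict U] v) :
    MemH10 U v :=
  ((hu.isH10Pair hU).congr huv (ae_eq_refl _)).memH10 hU

theorem MemH10.add (hU : IsOpen U) (hu : MemH10 U u) (hv : MemH10 U v) :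
    MemH10 U (fun x => u x + v x) :=
  ((hu.isH10Pair hU).add (hv.isH10Pair hU)).memH10 hU

theorem MemH10.sub (hU : IsOpen U) (hu : MemH10 U u) (hv : MemH10 U v) :
    MemH10 U (fun x => u x - v x) :=
  ((hu.isH10Pair hU).sub (hv.isH10Pair hU)).memH10 hU

theorem MemH10.const_mul (hU : IsOpen U) (c : ℝ) (hu : MemH10 U u) :
    MemH10 U (fun x => c * u x) :=
  ((hu.isH10Pair hU).const_mul c).memH10 hU

theorem MemH10.zero (hU : IsOpen U) : MemH10 U (fun _ => 0) := IsH10Pair.zero.memH10 hU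

theorem MemH10.sum (hU : IsOpen U) {ι : Type*} (s : Finset ι) {f : ι → Plane → ℝ}
    (hf : ∀ i ∈ s, MemH10 U (f i)) : MemH10 U (fun x => ∑ i ∈ s, f i x) := by
  classical
  induction s using Finset.induction_on with
  | empty => simpa using MemH10.zero hU
  | insert a s ha ih =>
    simp only [Finset.sum_insert ha]
    exact (hf a (Finset.mem_insert_self a s)).add hU
      (ih fun i hi => hf i (Finset.mem_insert_of_mem hi))

/-- The extension by zero of an element of `H¹₀(V)` belongs to `H¹₀(U)`, if `V ⊆ U`. -/
theorem IsH10Pair.indicator (hV : IsOpen V) (hVU : V ⊆ U) (hu : IsH10Pair V u g) :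
    IsH10Pair U (V.indicator u) (V.indicator g) := by
  have hr : (volume.restrict U).restrict V = volume.restrict V :=
    Measure.restrict_restrict_of_subset hVU
  obtain ⟨φ, hφ, h1, h2⟩ := hu.exists_approx
  refine IsH10Pair.of_tendsto (fun n => ((hφ n).mono hVU).isH10Pair) ?_ ?_ ?_ ?_
  · rw [memLp_indicator_iff_restrict hV.measurableSet, hr]; exact hu.memLp
  · rw [memLp_indicator_iff_restrict hV.measurableSet, hr]; exact hu.memLp_grad
  · refine h1.congr fun n => ?_
    rw [eLpNorm_sub_comm, ← hr, ← eLpNorm_indicator_eq_eLpNorm_restrict hV.measurableSet]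
    congr 1
    ext x
    by_cases hx : x ∈ V
    · simp [hx]
    · simp [hx, (hφ n).eq_zero hx]
  · refine h2.congr fun n => ?_
    rw [eLpNorm_sub_comm, ← hr, ← eLpNorm_indicator_eq_eLpNorm_restrict hV.measurableSet]
    congr 1
    ext x : 1
    by_cases hx : x ∈ V
    · simp [hx]
    · simp [hx, (hφ n).gradient_eq_zero hx]

theorem MemH10.indicator (hU : IsOpen U) (hV : IsOpen V) (hVU : V ⊆ U) (hu : MemH10 V u) :
    MemH10 U (V.indicator u) :=
  ((hu.isH10Pair hV).indicator hV hVU).memH10 hU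

/-! ## The Poincaré inequality -/

/-- In dimension 2 the Gagliardo–Nirenberg–Sobolev inequality at the exponents p = 1, q = 2 gives
‖φ‖₂ ≤ C₁‖∇φ‖₁, and Hölder on the bounded set U replaces the L¹ norm of the gradient by its L² norm.
-/
theorem exists_poincare_const_of_isTestFunction (hU : Bornology.IsBounded U) :
    ∃ C : NNReal, ∀ φ, IsTestFunction U φ →
      eLpNorm φ 2 (volume.restrict U) ≤ C * eLpNorm (gradient φ) 2 (volume.restrict U) := by
  have hfin : volume U < ⊤ := hU.measure_lt_top
  set C₁ := eLpNormLESNormFDerivOfLeConst ℝ (volume : Measure Plane) U 1 2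
  set c : NNReal := (volume U ^ (1 / (1 : ENNReal).toReal - 1 / (2 : ENNReal).toReal)).toNNReal
  have hc : (c : ENNReal) = volume U ^ (1 / (1 : ENNReal).toReal - 1 / (2 : ENNReal).toReal) :=
    ENNReal.coe_toNNReal (ENNReal.rpow_lt_top_of_nonneg (by norm_num) hfin.ne).ne
  refine ⟨C₁ * c, fun φ hφ => ?_⟩
  have h1 : eLpNorm φ 2 volume ≤ C₁ * eLpNorm (fderiv ℝ φ) 1 volume := by
    have := eLpNorm_le_eLpNorm_fderiv_of_le (F := ℝ) (volume : Measure Plane) (u := φ) (s := U)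
      hφ.contDiff_one ((subset_tsupport φ).trans hφ.tsupport_subset) (p := 1) (q := 2) le_rfl
      (by simp) (by simp; norm_num) hU
    exact_mod_cast this
  have h2 : eLpNorm (fderiv ℝ φ) 1 volume = eLpNorm (gradient φ) 1 (volume.restrict U) := by
    rw [eLpNorm_restrict_eq_of_support_subset]
    · exact eLpNorm_congr_norm_ae (Eventually.of_forall fun x => (norm_gradient φ x).symm)
    · intro x hx
      by_contra hxU
      exact hx (hφ.gradient_eq_zero hxU)
  have h3 := eLpNorm_le_eLpNorm_mul_rpow_measure_univ (p := 1) (q := 2)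
    (μ := volume.restrict U) (f := gradient φ) (by norm_num)
    hφ.continuous_gradient.aestronglyMeasurable
  rw [Measure.restrict_apply_univ, ← hc] at h3
  calc eLpNorm φ 2 (volume.restrict U) ≤ eLpNorm φ 2 volume :=
        eLpNorm_mono_measure _ Measure.restrict_le_self
    _ ≤ C₁ * (eLpNorm (gradient φ) 2 (volume.restrict U) * c) :=
        h1.trans (by rw [h2]; gcongr)
    _ = _ := by push_cast; ring

/-- The Poincaré inequality in `H¹₀(U)`, for `U` bounded. -/
theorem exists_poincare_const (hU : Bornology.IsBounded U) :
    ∃ C : NNReal, ∀ u g, IsH10Pair U u g → ∀ (hu : MemLp u 2 (volume.restrict U))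
      (hg : MemLp g 2 (volume.restrict U)), ‖hu.toLp‖ ≤ C * ‖hg.toLp‖ := by
  obtain ⟨C, hC⟩ := exists_poincare_const_of_isTestFunction hU
  refine ⟨C, fun u g hug hu hg => ?_⟩
  obtain ⟨_, _, h3⟩ := hug
  have key : ((testGraph U).topologicalClosure :
      Set (Lp ℝ 2 (volume.restrict U) × Lp Plane 2 (volume.restrict U))) ⊆ {p | ‖p.1‖ ≤ C * ‖p.2‖} := by
    rw [Submodule.topologicalClosure_coe]
    refine closure_minimal ?_ (isClosed_le (by fun_prop) (by fun_prop))
    rintro ⟨p, q⟩ ⟨φ, hφ, h4, h5⟩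
    have h6 := hC φ hφ
    rw [← eLpNorm_congr_ae h4, ← eLpNorm_congr_ae h5] at h6
    rw [mem_ofPred_eq, Lp.norm_def, Lp.norm_def, ← ENNReal.coe_toReal C, ← ENNReal.toReal_mul]
    exact ENNReal.toReal_mono (ENNReal.mul_ne_top ENNReal.coe_ne_top (Lp.eLpNorm_ne_top q)) h6
  have h4 := key h3
  rwa [mem_ofPred_eq] at h4

theorem IsH10Pair.ae_eq_zero (hU : Bornology.IsBounded U) (hu : IsH10Pair U u g)
    (hg : g =ᵐ[volume.restrict U] 0) : u =ᵐ[volume.restrict U] 0 := by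
  obtain ⟨C, hC⟩ := exists_poincare_const hU
  have h1 := hC u g hu hu.memLp hu.memLp_grad
  have h2 : hu.memLp_grad.toLp = 0 := by
    rw [MemLp.toLp_congr hu.memLp_grad MemLp.zero hg]; rfl
  rw [h2, norm_zero, mul_zero] at h1
  have h3 : hu.memLp.toLp = 0 := norm_le_zero_iff.1 h1
  filter_upwards [hu.memLp.coeFn_toLp, Lp.coeFn_zero ℝ 2 (volume.restrict U)] with x a b
  rw [← a, h3, b]

end VEM

end

namespace VEM

open scoped Convolution

/-! ## Mollification -/

/-- Translations preserve Lebesgue measure and depend continuously on t in the compact-open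
topology, so composition with them is continuous in L². -/
theorem tendsto_eLpNorm_translate_sub {E : Type*} [NormedAddCommGroup E] {f : Plane → E}
    (hf : MemLp f 2 volume) :
    Tendsto (fun t : Plane => eLpNorm (fun x => f (x - t) - f x) 2 volume) (𝓝 0) (𝓝 0) := by
  let G : Plane → C(Plane, Plane) := fun t => ⟨fun x => x - t, by fun_prop⟩
  have hG : Continuous G := by
    let H : C(Plane × Plane, Plane) := ⟨fun p => p.2 - p.1, by fun_prop⟩
    exact H.curry.continuous
  have hm : ∀ t, MeasurePreserving (G t) volume volume := fun t =>
    measurePreserving_sub_right volume t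
  have h1 := (continuous_const (y := hf.toLp)).compMeasurePreservingLp hG hm (by norm_num)
  have h2 := h1.tendsto 0
  rw [Lp.tendsto_Lp_iff_tendsto_eLpNorm'] at h2
  refine h2.congr fun t => eLpNorm_congr_ae ?_
  rw [Lp.toLp_compMeasurePreserving, Lp.toLp_compMeasurePreserving]
  filter_upwards [(hf.comp_measurePreserving (hm t)).coeFn_toLp,
    (hf.comp_measurePreserving (hm 0)).coeFn_toLp] with x a b
  rw [Pi.sub_apply, a, b]
  simp [G]

section Mollification

variable {E : Type*} [NormedAddCommGroup E] [NormedSpace ℝ E] [CompleteSpace E] {f : Plane → E}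

/-- The mollification `ρ ⋆ f` of `f` by the normalised bump function `ρ`. -/
noncomputable def mollify (ρ : ContDiffBump (0 : Plane)) (f : Plane → E) : Plane → E :=
  ρ.normed volume ⋆[ContinuousLinearMap.lsmul ℝ ℝ, volume] f

/-- The density ρ defines a probability measure ν, and the mollification error at x is the ν-average
of f(x - t) - f(x). Its square is at most the ν-average of the squares; exchanging the integrals by
Tonelli leaves a ν-average of squared L² norms of translation differences. -/
theorem eLpNorm_mollify_sub_le (ρ : ContDiffBump (0 : Plane)) (hf : MemLp f 2 volume)
    {ε : ENNReal} (hε : ∀ t ∈ Metric.ball (0 : Plane) ρ.rOut,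
      eLpNorm (fun x => f (x - t) - f x) 2 volume ≤ ε) :
    eLpNorm (fun x => mollify ρ f x - f x) 2 volume ≤ ε := by
  set r : Plane → NNReal := fun t => (ρ.normed volume t).toNNReal with hr
  have hrc : Continuous r := continuous_real_toNNReal.comp ρ.continuous_normed
  have hr' : ∀ t, (r t : ℝ) = ρ.normed volume t := fun t => Real.coe_toNNReal _ (ρ.nonneg_normed t)
  set ν : Measure Plane := volume.withDensity (fun t => (r t : ENNReal)) with hν
  have hν1 : IsProbabilityMeasure ν := by
    constructor
    rw [hν, withDensity_apply _ MeasurableSet.univ, Measure.restrict_univ]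
    have := ofReal_integral_eq_lintegral_ofReal (ρ.integrable_normed (μ := volume))
      (Eventually.of_forall fun t => ρ.nonneg_normed t)
    rw [ρ.integral_normed, ENNReal.ofReal_one] at this
    exact this.symm
  have hloc : LocallyIntegrable f volume := hf.locallyIntegrable (by norm_num)
  have step1 : ∀ x, ‖mollify ρ f x - f x‖ₑ ^ (2 : ℝ) ≤
      ∫⁻ t, ‖f (x - t) - f x‖ₑ ^ (2 : ℝ) ∂ν := by
    intro x
    have hint : Integrable (fun t => f (x - t)) ν := by
      rw [hν, integrable_withDensity_iff_integrable_smul hrc.measurable]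
      have := (ρ.hasCompactSupport_normed (μ := volume)).convolutionExists_left
        (ContinuousLinearMap.lsmul ℝ ℝ) ρ.continuous_normed hloc x
      refine this.congr (Eventually.of_forall fun t => ?_)
      change _ = r t • f (x - t)
      rw [NNReal.smul_def, hr']
      rfl
    have e1 : mollify ρ f x - f x = ∫ t, (f (x - t) - f x) ∂ν := by
      rw [integral_sub hint (integrable_const _), integral_const, probReal_univ, one_smul, hν,
        integral_withDensity_eq_integral_smul hrc.measurable, mollify, convolution_def]
      congr 1
      refine integral_congr_ae (Eventually.of_forall fun t => ?_)
      change _ = r t • f (x - t)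
      rw [NNReal.smul_def, hr']
      rfl
    have h3 : ‖mollify ρ f x - f x‖ₑ ≤ eLpNorm (fun t => f (x - t) - f x) 2 ν := by
      rw [e1]
      refine (enorm_integral_le_lintegral_enorm _).trans ?_
      rw [← eLpNorm_one_eq_lintegral_enorm]
      exact eLpNorm_le_eLpNorm_of_exponent_le (by norm_num)
        (hint.sub (integrable_const _)).aestronglyMeasurable
    calc ‖mollify ρ f x - f x‖ₑ ^ (2 : ℝ) ≤ eLpNorm (fun t => f (x - t) - f x) 2 ν ^ (2 : ℝ) := by
          gcongr
      _ = _ := by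
          have := eLpNorm_nnreal_pow_eq_lintegral (f := fun t => f (x - t) - f x) (μ := ν) (p := 2)
            two_ne_zero
          simpa using this
  have hmeas : AEMeasurable (Function.uncurry fun x t => ‖f (x - t) - f x‖ₑ ^ (2 : ℝ))
      (volume.prod ν) := by
    have h1 : AEStronglyMeasurable (fun p : Plane × Plane => f (p.1 - p.2)) (volume.prod ν) :=
      hf.aestronglyMeasurable.comp_quasiMeasurePreserving (quasiMeasurePreserving_sub volume ν)
    have h2 : AEStronglyMeasurable (fun p : Plane × Plane => f p.1) (volume.prod ν) :=
      hf.aestronglyMeasurable.comp_fst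
    exact (h1.sub h2).enorm.pow_const _
  have hsq : ∀ h : Plane → E, eLpNorm h 2 volume ^ (2 : ℝ) = ∫⁻ x, ‖h x‖ₑ ^ (2 : ℝ) := by
    intro h
    have := eLpNorm_nnreal_pow_eq_lintegral (f := h) (μ := volume) (p := 2) two_ne_zero
    simpa using this
  rw [← ENNReal.rpow_le_rpow_iff (z := 2) two_pos, hsq]
  calc ∫⁻ x, ‖mollify ρ f x - f x‖ₑ ^ (2 : ℝ)
      ≤ ∫⁻ x, ∫⁻ t, ‖f (x - t) - f x‖ₑ ^ (2 : ℝ) ∂ν := lintegral_mono step1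
    _ = ∫⁻ t, ∫⁻ x, ‖f (x - t) - f x‖ₑ ^ (2 : ℝ) ∂volume ∂ν := lintegral_lintegral_swap hmeas
    _ ≤ ∫⁻ _t, ε ^ (2 : ℝ) ∂ν := by
        refine lintegral_mono_ae ?_
        -- Only shifts t with ρ(t) ≠ 0 count for ν, and these lie in the ball of radius `rOut`.
        rw [hν, ae_withDensity_iff (by exact hrc.measurable.coe_nnreal_ennreal)]
        refine Eventually.of_forall fun t ht => ?_
        rw [← hsq]
        have : t ∈ Metric.ball (0 : Plane) ρ.rOut := by
          rw [← ρ.support_normed_eq (μ := volume)]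
          intro h0
          exact ht (by simp [hr, h0])
        gcongr
        exact hε t this
    _ = ε ^ (2 : ℝ) := by simp

theorem tendsto_eLpNorm_mollify_sub {ρ : ℕ → ContDiffBump (0 : Plane)}
    (hρ : Tendsto (fun n => (ρ n).rOut) atTop (𝓝 0)) (hf : MemLp f 2 volume) :
    Tendsto (fun n => eLpNorm (fun x => mollify (ρ n) f x - f x) 2 volume) atTop (𝓝 0) := by
  rw [ENNReal.tendsto_nhds_zero]
  intro ε hε
  have h1 := (ENNReal.tendsto_nhds_zero.1 (tendsto_eLpNorm_translate_sub hf)) ε hε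
  obtain ⟨δ, hδ, h2⟩ := Metric.eventually_nhds_iff_ball.1 h1
  filter_upwards [hρ.eventually (gt_mem_nhds hδ)] with n hn
  exact eLpNorm_mollify_sub_le (ρ n) hf fun t ht => h2 t (Metric.ball_subset_ball hn.le ht)

end Mollification

theorem contDiff_mollify (ρ : ContDiffBump (0 : Plane)) {u : Plane → ℝ}
    (hu : LocallyIntegrable u volume) : ContDiff ℝ ∞ (mollify ρ u) :=
  (ρ.hasCompactSupport_normed (μ := volume)).contDiff_convolution_left _ (n := ⊤)
    ρ.contDiff_normed hu

/-- Differentiation falls on ρ, and y ↦ ρ(x - y) is a test function, so the definition of the weak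
gradient moves the derivative onto u. The sign from the reflection y ↦ x - y cancels the sign of the
integration by parts. -/
theorem gradient_mollify (ρ : ContDiffBump (0 : Plane)) {u : Plane → ℝ} {g : Plane → Plane}
    (hu : IsH1Pair univ u g) (x : Plane) : gradient (mollify ρ u) x = mollify ρ g x := by
  have hul : MemLp u 2 volume := by simpa using hu.memLp
  have hgl : MemLp g 2 volume := by simpa using hu.memLp_grad
  set r := ρ.normed volume with hr
  have hrd : ContDiff ℝ ∞ r := ρ.contDiff_normed
  have hrc : HasCompactSupport r := ρ.hasCompactSupport_normed
  have hr1 : ContDiff ℝ 1 r := hrd.of_le (by exact_mod_cast le_top)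
  refine ext_inner_right ℝ fun e => ?_
  have hd := hrc.hasFDerivAt_convolution_left (ContinuousLinearMap.lsmul ℝ ℝ) hr1
    (hul.locallyIntegrable (by norm_num)) (μ := volume) (g := u) x
  rw [inner_gradient, mollify, hd.fderiv, convolution_def]
  have hex1 := (hrc.fderiv ℝ).convolutionExists_left (μ := volume)
    ((ContinuousLinearMap.lsmul ℝ ℝ).precompL Plane) (hr1.continuous_fderiv one_ne_zero)
    (hul.locallyIntegrable (by norm_num)) x
  have hex2 := hrc.convolutionExists_left (μ := volume)
    (ContinuousLinearMap.lsmul ℝ ℝ) hr1.continuous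
    (hgl.locallyIntegrable (by norm_num)) x
  rw [ContinuousLinearMap.integral_apply hex1]
  have e2 : ⟪mollify ρ g x, e⟫ = ∫ t, r t * ⟪g (x - t), e⟫ := by
    rw [mollify, convolution_def, real_inner_comm, ← integral_inner hex2]
    refine integral_congr_ae (Eventually.of_forall fun t => ?_)
    simp [inner_smul_right, real_inner_comm e, hr]
  rw [e2]
  have hφ : IsTestFunction univ (fun y => r (x - y)) := by
    refine ⟨hrd.comp (by fun_prop), ?_, subset_univ _⟩
    exact hrc.comp_homeomorph (Homeomorph.subLeft x)
  have key := hu.integral_eq _ hφ e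
  rw [Measure.restrict_univ] at key
  have hgr : ∀ y, ⟪gradient (fun y => r (x - y)) y, e⟫ = -fderiv ℝ r (x - y) e := by
    intro y
    have h1 : HasFDerivAt (fun y => r (x - y))
        ((fderiv ℝ r (x - y)).comp (-ContinuousLinearMap.id ℝ Plane)) y := by
      refine ((hr1.differentiable one_ne_zero) (x - y)).hasFDerivAt.comp y ?_
      simpa using (hasFDerivAt_id y).const_sub x
    rw [inner_gradient, h1.fderiv]
    simp
  simp only [hgr, mul_neg, integral_neg, neg_inj] at key
  rw [← integral_sub_left_eq_self (fun t => r t * ⟪g (x - t), e⟫) volume x]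
  simp only [sub_sub_cancel]
  rw [← key, ← integral_sub_left_eq_self (fun y => u y * fderiv ℝ r (x - y) e) volume x]
  refine integral_congr_ae (Eventually.of_forall fun t => ?_)
  simp [mul_comm]

end VEM

namespace VEM

variable {U : Set Plane} {u : Plane → ℝ} {g : Plane → Plane}

/-! ## Continuous `H¹` functions vanishing on the boundary -/

/-- Dominated convergence for the squared norms, with majorant ‖2M f‖²: the limit c₀ inherits the
bound M almost everywhere. -/
theorem tendsto_eLpNorm_smul_sub {X E : Type*} [MeasurableSpace X] {μ : Measure X}
    [NormedAddCommGroup E] [NormedSpace ℝ E] {c : ℕ → X → ℝ} {c₀ : X → ℝ} {f : X → E} {M : ℝ}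
    (hf : MemLp f 2 μ) (hc : ∀ n, AEStronglyMeasurable (c n) μ) (hM : ∀ n x, |c n x| ≤ M)
    (hlim : ∀ᵐ x ∂μ, Tendsto (fun n => c n x) atTop (𝓝 (c₀ x))) :
    Tendsto (fun n => eLpNorm (fun x => c n x • f x - c₀ x • f x) 2 μ) atTop (𝓝 0) := by
  have hc₀ : AEStronglyMeasurable c₀ μ := aestronglyMeasurable_of_tendsto_ae atTop hc hlim
  have key : Tendsto (fun n => ∫⁻ x, ‖c n x • f x - c₀ x • f x‖ₑ ^ (2 : ℝ) ∂μ) atTop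
      (𝓝 (∫⁻ _x, 0 ∂μ)) := by
    refine tendsto_lintegral_of_dominated_convergence'
      (fun x => ‖(2 * M) • f x‖ₑ ^ (2 : ℝ)) (fun n => ?_) (fun n => ?_) ?_ ?_
    · exact (((hc n).smul hf.aestronglyMeasurable).sub
        (hc₀.smul hf.aestronglyMeasurable)).enorm.pow_const _
    · filter_upwards [hlim] with x hx
      have h0 : |c₀ x| ≤ M := le_of_tendsto hx.abs (Eventually.of_forall fun n => hM n x)
      gcongr
      rw [← sub_smul, enorm_le_iff_norm_le, norm_smul, norm_smul, Real.norm_eq_abs, Real.norm_eq_abs]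
      refine mul_le_mul_of_nonneg_right ?_ (norm_nonneg _)
      calc |c n x - c₀ x| ≤ |c n x| + |c₀ x| := abs_sub _ _
        _ ≤ 2 * M := by linarith [hM n x]
        _ ≤ |2 * M| := le_abs_self _
    · have := (hf.const_smul (2 * M)).eLpNorm_lt_top
      rw [eLpNorm_lt_top_iff_lintegral_rpow_enorm_lt_top two_ne_zero (by norm_num)] at this
      simpa using this.ne
    · filter_upwards [hlim] with x hx
      have h1 : Tendsto (fun n => ‖c n x • f x - c₀ x • f x‖ₑ) atTop (𝓝 0) := by
        have := ((hx.smul_const (f x)).sub_const (c₀ x • f x)).enorm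
        simpa using this
      have := h1.ennrpow_const 2
      simpa using this
  rw [lintegral_zero] at key
  have := key.ennrpow_const (1 / 2)
  simpa [eLpNorm_eq_lintegral_rpow_enorm_toReal] using this

/-- A smooth approximation of the identity of `ℝ` that vanishes near `0`. -/
theorem exists_smooth_truncation : ∃ ζ : ℝ → ℝ, ContDiff ℝ ∞ ζ ∧ (∀ s, |s| ≤ 1 → ζ s = 0) ∧
    (∀ s, |ζ s - s| ≤ 2) ∧ (∃ M, ∀ s, |deriv ζ s| ≤ M) ∧ (∀ s, |s| < 1 → deriv ζ s = 0) ∧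
    ∀ s, 2 < |s| → deriv ζ s = 1 := by
  let b : ContDiffBump (0 : ℝ) := ⟨1, 2, one_pos, one_lt_two⟩
  have hb : ContDiff ℝ ∞ b := b.contDiff
  have h1 : ∀ s, |s| ≤ 1 → b s = 1 := fun s hs => b.one_of_mem_closedBall (by simpa [b] using hs)
  have h2 : ∀ s, 2 ≤ |s| → b s = 0 := fun s hs => b.zero_of_le_dist (by simpa [b] using hs)
  have hp : ContDiff ℝ ∞ (fun s => s * b s) := contDiff_id.mul hb
  have hpd : Differentiable ℝ (fun s => s * b s) := hp.differentiable (by simp)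
  have hd : ∀ s, deriv (fun s => s - s * b s) s = 1 - deriv (fun s => s * b s) s := by
    intro s
    have := (hasDerivAt_id s).sub (hpd s).hasDerivAt
    exact this.deriv
  have hz : ∀ s, |s| ≤ 1 → s - s * b s = 0 := fun s hs => by rw [h1 s hs]; ring
  refine ⟨fun s => s - s * b s, contDiff_id.sub hp, hz, fun s => ?_, ?_, fun s hs => ?_,
    fun s hs => ?_⟩
  · rw [sub_sub_cancel_left, abs_neg, abs_mul, abs_of_nonneg b.nonneg]
    rcases le_total |s| 2 with h | h
    · calc |s| * b s ≤ 2 * 1 := mul_le_mul h b.le_one b.nonneg (by norm_num)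
        _ = 2 := by norm_num
    · rw [h2 s h]; norm_num
  · have hcs : HasCompactSupport (fun s => s * b s) := b.hasCompactSupport.mul_left
    obtain ⟨C, hC⟩ := (hp.continuous_deriv (by simp)).bounded_above_of_compact_support hcs.deriv
    refine ⟨1 + C, fun s => ?_⟩
    rw [hd]
    calc |1 - deriv (fun s => s * b s) s| ≤ |1| + |deriv (fun s => s * b s) s| := abs_sub _ _
      _ ≤ 1 + C := by rw [abs_one]; gcongr; exact hC s
  · have : (fun s => s - s * b s) =ᶠ[𝓝 s] fun _ => 0 := by
      filter_upwards [continuous_abs.continuousAt.preimage_mem_nhds (gt_mem_nhds hs)] with t ht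
      exact hz t (le_of_lt ht)
    rw [this.deriv_eq, deriv_const]
  · have : (fun s => s - s * b s) =ᶠ[𝓝 s] fun s => s := by
      filter_upwards [continuous_abs.continuousAt.preimage_mem_nhds (lt_mem_nhds hs)] with t ht
      rw [h2 t (le_of_lt ht)]; ring
    rw [this.deriv_eq, deriv_id'']

/-- Multiplication by a test function, and extension by zero. -/
theorem IsH1Pair.cutoff {χ : Plane → ℝ} (hU : IsOpen U) (hu : IsH1Pair U u g)
    (hχ : IsTestFunction U χ) :
    IsH1Pair univ (fun x => χ x * u x) (fun x => χ x • g x + u x • gradient χ x) := by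
  have hχ2 := hχ.memLp (volume.restrict U) ⊤
  have hχ3 := hχ.memLp_gradient (volume.restrict U) ⊤
  have m1 : MemLp (fun x => χ x * u x) 2 (volume.restrict U) := hu.memLp.smul hχ2
  have m2 : MemLp (fun x => χ x • g x) 2 (volume.restrict U) := hu.memLp_grad.smul hχ2
  have m3 : MemLp (fun x => u x • gradient χ x) 2 (volume.restrict U) := hχ3.smul hu.memLp
  refine ⟨?_, ?_, fun φ hφ e => ?_⟩
  · rw [Measure.restrict_univ]
    have : (fun x => χ x * u x) = U.indicator (fun x => χ x * u x) := by
      ext x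
      by_cases hx : x ∈ U
      · simp [hx]
      · simp [hx, hχ.eq_zero hx]
    rw [this]
    exact (memLp_indicator_iff_restrict hU.measurableSet).2 m1
  · rw [Measure.restrict_univ]
    have : (fun x => χ x • g x + u x • gradient χ x) =
        U.indicator (fun x => χ x • g x + u x • gradient χ x) := by
      ext x : 1
      by_cases hx : x ∈ U
      · simp [hx]
      · simp [hx, hχ.eq_zero hx, hχ.gradient_eq_zero hx]
    rw [this]
    exact (memLp_indicator_iff_restrict hU.measurableSet).2 (m2.add m3)
  · have hψ : IsTestFunction U (fun x => χ x * φ x) := hχ.smooth_mul hφ.contDiff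
    have key := hu.integral_eq _ hψ e
    have p1 := hφ.memLp (volume.restrict U) 2
    have p2 := MemLp.inner_const_two (hφ.memLp_gradient (volume.restrict U) 2) e
    have i1 := integrable_mul_of_memLp_two m1 p2
    have i2 := integrable_mul_of_memLp_two p1 (MemLp.inner_const_two m3 e)
    have i3 := integrable_mul_of_memLp_two p1 (MemLp.inner_const_two m2 e)
    have e1 : ∫ x in U, u x * ⟪gradient (fun x => χ x * φ x) x, e⟫ =
        (∫ x in U, χ x * u x * ⟪gradient φ x, e⟫) +
          ∫ x in U, φ x * ⟪u x • gradient χ x, e⟫ := by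
      rw [← integral_add i1 i2]
      refine integral_congr_ae (Eventually.of_forall fun x => ?_)
      simp only [gradient_mul' (hχ.differentiable x) (hφ.differentiable x), inner_add_left,
        inner_smul_left, RCLike.conj_to_real]
      ring
    have e2 : ∫ x in U, φ x * ⟪χ x • g x + u x • gradient χ x, e⟫ =
        (∫ x in U, φ x * ⟪χ x • g x, e⟫) + ∫ x in U, φ x * ⟪u x • gradient χ x, e⟫ := by
      rw [← integral_add i3 i2]
      refine integral_congr_ae (Eventually.of_forall fun x => ?_)
      simp only [inner_add_left]
      ring
    have e3 : ∫ x in U, χ x * φ x * ⟪g x, e⟫ = ∫ x in U, φ x * ⟪χ x • g x, e⟫ := by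
      refine integral_congr_ae (Eventually.of_forall fun x => ?_)
      simp only [inner_smul_left, RCLike.conj_to_real]
      ring
    rw [Measure.restrict_univ,
      ← setIntegral_eq_integral_of_forall_compl_eq_zero (s := U) (fun x hx => by
        rw [hχ.eq_zero hx]; ring),
      ← setIntegral_eq_integral_of_forall_compl_eq_zero (s := U) (f := fun x => φ x * _)
        (fun x hx => by
        rw [hχ.eq_zero hx, hχ.gradient_eq_zero hx]; simp), e2]
    linarith

/-- Two compact sets are inserted between K and U: χ is 1 on the inner one, hence near each point of
K (which makes ∇χ vanish on K), and it is supported in the outer one. -/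
theorem exists_cutoff {K : Set Plane} (hK : IsCompact K) (hU : IsOpen U) (hKU : K ⊆ U) :
    ∃ χ : Plane → ℝ, IsTestFunction U χ ∧ (∀ x, 0 ≤ χ x ∧ χ x ≤ 1) ∧
      ∀ x ∈ K, ∀ᶠ y in 𝓝 x, χ y = 1 := by
  obtain ⟨K₁, hK₁, h1, h2⟩ := exists_compact_between hK hU hKU
  obtain ⟨K₂, hK₂, h3, h4⟩ := exists_compact_between hK₁ hU h2
  obtain ⟨χ, c1, c2, c3, c4⟩ := exists_contMDiff_support_eq_eq_one_iff (n := ⊤)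
    (modelWithCornersSelf ℝ Plane) (isOpen_interior (s := K₂)) hK₁.isClosed h3
  have hts : tsupport χ ⊆ K₂ := by
    rw [tsupport, c3]
    exact closure_minimal interior_subset hK₂.isClosed
  refine ⟨χ, ⟨c1.contDiff, hK₂.of_isClosed_subset (isClosed_tsupport χ) hts, hts.trans h4⟩,
    fun x => c2 (mem_range_self x), fun x hx => ?_⟩
  filter_upwards [mem_interior_iff_mem_nhds.1 (h1 hx)] with y hy
  exact (c4 y).1 hy

/-- The truncation `η ∘ u` of `u`, where `η` vanishes near `0`. -/
theorem IsH1Pair.isH10Pair_truncate {η : ℝ → ℝ} {ε M : ℝ} (hU : IsOpen U) (hu : IsH1Pair U u g)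
    (huc : ContinuousOn u U) (hK : IsCompact {x ∈ U | ε ≤ |u x|})
    (hε : 0 < ε) (hη : ContDiff ℝ ∞ η) (hη0 : ∀ s, |s| < ε → η s = 0) (hM : ∀ s, |deriv η s| ≤ M)
    (hη' : ∀ s, |s| < ε → deriv η s = 0) :
    IsH10Pair U (fun x => η (u x)) (fun x => deriv η (u x) • g x) := by
  -- Cutting off near the compact set {|u| ≥ ε} gives w = χu, continuous with compact support and in
  -- H¹ of the whole plane, so it can be mollified without regard to ∂U.
  obtain ⟨χ, hχ, hχ01, hχ1⟩ := exists_cutoff hK hU (fun x hx => hx.1)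
  set w : Plane → ℝ := fun x => χ x * u x with hw
  set h : Plane → Plane := fun x => χ x • g x + u x • gradient χ x with hh
  have hwh : IsH1Pair univ w h := hu.cutoff hU hχ
  have hwL : MemLp w 2 volume := by simpa using hwh.memLp
  have hhL : MemLp h 2 volume := by simpa using hwh.memLp_grad
  have hwt : tsupport w ⊆ tsupport χ := tsupport_mul_subset_left
  have hwc : Continuous w := by
    refine continuous_of_tsupport fun x hx => ?_
    exact hχ.contDiff.continuous.continuousAt.mul
      (huc.continuousAt (hU.mem_nhds (hχ.tsupport_subset (hwt hx))))
  obtain ⟨δ, hδ, hδU⟩ := hχ.hasCompactSupport.isCompact.exists_cthickening_subset_open hU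
    hχ.tsupport_subset
  have hpos : ∀ n : ℕ, 0 < δ / (n + 1) := fun n => by positivity
  let ρ : ℕ → ContDiffBump (0 : Plane) := fun n =>
    ⟨δ / (n + 1) / 2, δ / (n + 1), by have := hpos n; positivity, half_lt_self (hpos n)⟩
  have hρ : Tendsto (fun n => (ρ n).rOut) atTop (𝓝 0) :=
    tendsto_const_div_atTop_nhds_zero_nat δ |>.comp (tendsto_add_atTop_nat 1) |>.congr fun n => by
      simp [ρ]
  have hρδ : ∀ n, (ρ n).rOut ≤ δ := fun n =>
    div_le_self hδ.le (by have : (0 : ℝ) ≤ n := n.cast_nonneg; linarith)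
  have hη00 : η 0 = 0 := hη0 0 (by simpa using hε)
  have hη1 : ContDiff ℝ 1 η := hη.of_le (by exact_mod_cast le_top)
  have hηd : Differentiable ℝ η := hη1.differentiable one_ne_zero
  have hηc : Continuous (deriv η) := hη1.continuous_deriv le_rfl
  have hwloc : LocallyIntegrable w volume := hwL.locallyIntegrable (by norm_num)
  have hmd : ∀ n, ContDiff ℝ ∞ (mollify (ρ n) w) := fun n => contDiff_mollify _ hwloc
  -- Since η(0) = 0, the support of η(ρ_n ⋆ w) stays within distance δ of the support of χ, hence in
  -- a compact subset of U.
  have htest : ∀ n, IsTestFunction U (fun x => η (mollify (ρ n) w x)) := by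
    intro n
    have hsub : tsupport (fun x => η (mollify (ρ n) w x)) ⊆ Metric.cthickening δ (tsupport χ) := by
      refine closure_minimal (fun x hx => ?_) Metric.isClosed_cthickening
      have hx1 : x ∈ Function.support (mollify (ρ n) w) := fun h0 => hx (by simp only [h0, hη00])
      obtain ⟨a, ha, b, hb, rfl⟩ := support_convolution_subset _ hx1
      rw [(ρ n).support_normed_eq] at ha
      refine Metric.mem_cthickening_of_dist_le _ b _ _ (hwt (subset_tsupport w hb)) ?_
      simp only [Metric.mem_ball, dist_zero_right] at ha
      simpa [dist_eq_norm] using ha.le.trans (hρδ n)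
    exact ⟨hη.comp (hmd n), (hχ.hasCompactSupport.isCompact.cthickening).of_isClosed_subset
      (isClosed_tsupport _) hsub, hsub.trans hδU⟩
  have hgrad : ∀ n x, gradient (fun x => η (mollify (ρ n) w x)) x =
      deriv η (mollify (ρ n) w x) • mollify (ρ n) h x := by
    intro n x
    rw [← gradient_mollify (ρ n) hwh]
    have h1 := (hηd (mollify (ρ n) w x)).hasDerivAt.comp_hasFDerivAt x
      (((hmd n).differentiable (by simp)) x).hasFDerivAt
    have h2 : fderiv ℝ (fun x => η (mollify (ρ n) w x)) x = _ := h1.fderiv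
    simp [gradient, h2]
  have hlip : ∀ s t, |η s - η t| ≤ M * |s - t| := fun s t =>
    convex_univ.norm_image_sub_le_of_norm_deriv_le (fun x _ => hηd x) (fun x _ => hM x)
      (mem_univ t) (mem_univ s)
  have hM0 : 0 ≤ M := (abs_nonneg _).trans (hM 0)
  have hle : volume.restrict U ≤ (volume : Measure Plane) := Measure.restrict_le_self
  have hbd : ∀ {a : Plane → ℝ}, Continuous a → MemLp (fun x => deriv η (a x)) ⊤ volume :=
    fun {a} ha => memLp_top_of_bound (hηc.comp ha).aestronglyMeasurable M
      (Eventually.of_forall fun x => hM _)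
  have main : IsH10Pair U (fun x => η (w x)) (fun x => deriv η (w x) • h x) := by
    refine IsH10Pair.of_tendsto (fun n => (htest n).isH10Pair) ?_ ?_ ?_ ?_
    · have : MemLp (fun x => η (w x)) 2 volume := by
        refine MemLp.of_le_mul (c := M) hwL
          (hη.continuous.comp hwc).aestronglyMeasurable (Eventually.of_forall fun x => ?_)
        have := hlip (w x) 0
        simpa [hη00] using this
      exact this.mono_measure hle
    · exact (hhL.smul (hbd hwc) : MemLp _ 2 _).mono_measure hle
    · refine tendsto_of_tendsto_of_tendsto_of_le_of_le tendsto_const_nhds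
        (h := fun n => ENNReal.ofReal M * eLpNorm (fun x => mollify (ρ n) w x - w x) 2 volume)
        ?_ (fun _ => zero_le) (fun n => ?_)
      · simpa using ENNReal.Tendsto.const_mul (tendsto_eLpNorm_mollify_sub hρ hwL)
          (Or.inr ENNReal.ofReal_ne_top)
      · refine (eLpNorm_mono_measure _ hle).trans ?_
        exact eLpNorm_le_mul_eLpNorm_of_ae_le_mul
          (Eventually.of_forall fun x => hlip _ _) 2
    · have t1 : Tendsto (fun n => ENNReal.ofReal M *
          eLpNorm (fun x => mollify (ρ n) h x - h x) 2 volume) atTop (𝓝 0) := by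
        simpa using ENNReal.Tendsto.const_mul (tendsto_eLpNorm_mollify_sub hρ hhL)
          (Or.inr ENNReal.ofReal_ne_top)
      have t2 : Tendsto (fun n => eLpNorm (fun x => deriv η (mollify (ρ n) w x) • h x -
          deriv η (w x) • h x) 2 volume) atTop (𝓝 0) := by
        refine tendsto_eLpNorm_smul_sub hhL
          (fun n => (hηc.comp (hmd n).continuous).aestronglyMeasurable) (fun n x => hM _)
          (Eventually.of_forall fun x => ?_)
        exact (hηc.tendsto _).comp
          (ContDiffBump.convolution_tendsto_right_of_continuous hρ hwc x)
      refine tendsto_of_tendsto_of_tendsto_of_le_of_le tendsto_const_nhds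
        (by simpa using t1.add t2) (fun _ => zero_le) (fun n => ?_)
      refine (eLpNorm_mono_measure _ hle).trans ?_
      have hmc : Continuous (mollify (ρ n) h) :=
        ((ρ n).hasCompactSupport_normed (μ := volume)).continuous_convolution_left _
          (ρ n).continuous_normed (hhL.locallyIntegrable (by norm_num))
      have hcn : AEStronglyMeasurable (fun x => deriv η (mollify (ρ n) w x)) volume :=
        (hηc.comp (hmd n).continuous).aestronglyMeasurable
      -- The first summand is small because η' is bounded and ρ_n ⋆ h → h in L². The second tends to
      -- 0 by dominated convergence, the mollifications of the continuous w converging at every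
      -- point.
      have hdec : ((fun x => gradient (fun x => η (mollify (ρ n) w x)) x) -
          fun x => deriv η (w x) • h x) =
          (fun x => deriv η (mollify (ρ n) w x) • (mollify (ρ n) h x - h x)) +
          fun x => deriv η (mollify (ρ n) w x) • h x - deriv η (w x) • h x := by
        ext x : 1
        simp only [Pi.sub_apply, Pi.add_apply, hgrad, smul_sub]
        abel
      have hsub : AEStronglyMeasurable (fun x => mollify (ρ n) h x - h x) volume :=
        hmc.aestronglyMeasurable.sub hhL.aestronglyMeasurable
      refine (le_of_eq (congrArg (fun f => eLpNorm f 2 volume) hdec)).trans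
        ((eLpNorm_add_le (hcn.smul hsub) ((hcn.smul hhL.aestronglyMeasurable).sub
          ((hηc.comp hwc).aestronglyMeasurable.smul hhL.aestronglyMeasurable))
          (by norm_num)).trans ?_)
      refine add_le_add_left (eLpNorm_le_mul_eLpNorm_of_ae_le_mul
        (Eventually.of_forall fun x => ?_) 2) _
      have := hM (mollify (ρ n) w x)
      rw [← Real.norm_eq_abs] at this
      exact (norm_smul_le _ _).trans (mul_le_mul_of_nonneg_right this (norm_nonneg _))
  -- Where |u| < ε also |w| < ε, and η and η' vanish at both values; elsewhere χ = 1 in a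
  -- neighbourhood, so w = u and h = g.
  have hcase : ∀ x ∈ U, η (w x) = η (u x) ∧ deriv η (w x) • h x = deriv η (u x) • g x := by
    intro x hx
    rcases lt_or_ge |u x| ε with hlt | hge
    · have hwx : |w x| < ε := by
        rw [hw, abs_mul, abs_of_nonneg (hχ01 x).1]
        exact (mul_le_of_le_one_left (abs_nonneg _) (hχ01 x).2).trans_lt hlt
      rw [hη0 _ hlt, hη0 _ hwx, hη' _ hlt, hη' _ hwx]
      simp
    · have h1 := hχ1 x ⟨hx, hge⟩
      have h2 : χ x = 1 := h1.self_of_nhds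
      have h3 : gradient χ x = 0 := by
        have : χ =ᶠ[𝓝 x] fun _ => 1 := h1
        rw [this.gradient_eq, gradient_fun_const]
      simp [hw, hh, h2, h3]
  refine main.congr ?_ ?_
  · filter_upwards [self_mem_ae_restrict hU.measurableSet] with x hx using (hcase x hx).1
  · filter_upwards [self_mem_ae_restrict hU.measurableSet] with x hx using (hcase x hx).2

/-- On a bounded open set, an `H¹` function that is continuous up to the boundary and vanishes
there belongs to `H¹₀`. -/
theorem MemH1.memH10_of_eqOn_frontier (hU : IsOpen U) (hb : Bornology.IsBounded U)
    (hu : MemH1 U u) (hc : ContinuousOn u (closure U)) (h0 : ∀ x ∈ frontier U, u x = 0) :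
    MemH10 U u := by
  obtain ⟨ζ, hζ, hζ0, hζ2, ⟨M, hM⟩, hζ', hζ1⟩ := exists_smooth_truncation
  have hp := hu.isH1Pair
  have hζd : Differentiable ℝ ζ := hζ.differentiable (by simp)
  have hζc : Continuous (deriv ζ) := hζ.continuous_deriv (by simp)
  have hucU : ContinuousOn u U := hc.mono subset_closure
  have hum : AEStronglyMeasurable u (volume.restrict U) := hu.memLp.aestronglyMeasurable
  set ε : ℕ → ℝ := fun n => 1 / ((n : ℝ) + 1) with hε
  have hεpos : ∀ n, 0 < ε n := fun n => by positivity
  have hεlim : Tendsto ε atTop (𝓝 0) := tendsto_one_div_add_atTop_nhds_zero_nat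
  have hder : ∀ n s, deriv (fun s => ε n * ζ (s / ε n)) s = deriv ζ (s / ε n) := by
    intro n s
    have h1 := ((hζd (s / ε n)).hasDerivAt.comp s ((hasDerivAt_id s).div_const (ε n))).const_mul
      (ε n)
    have h2 : deriv (fun s => ε n * ζ (s / ε n)) s = _ := h1.deriv
    rw [h2]
    have := (hεpos n).ne'
    field_simp
  have habs : ∀ n s, |s / ε n| = |s| / ε n := fun n s => by
    rw [abs_div, abs_of_pos (hεpos n)]
  have htr : ∀ n, IsH10Pair U (fun x => ε n * ζ (u x / ε n))
      (fun x => deriv ζ (u x / ε n) • weakGrad U u x) := by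
    intro n
    -- This is where the boundary condition enters: {|u| ≥ ε} is closed in the closure of U and
    -- misses the frontier, so it is a compact subset of U.
    have hK : IsCompact {x ∈ U | ε n ≤ |u x|} := by
      have : {x ∈ U | ε n ≤ |u x|} = closure U ∩ (fun x => |u x|) ⁻¹' Ici (ε n) := by
        ext x
        constructor
        · rintro ⟨h1, h2⟩
          exact ⟨subset_closure h1, h2⟩
        · rintro ⟨h1, h2⟩
          refine ⟨?_, h2⟩
          by_contra hx
          have h3 := h0 x ⟨h1, by rwa [hU.interior_eq]⟩
          have h4 : ε n ≤ |u x| := h2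
          rw [h3, abs_zero] at h4
          exact absurd h4 (not_le.2 (hεpos n))
      rw [this]
      exact hb.isCompact_closure.of_isClosed_subset
        (hc.abs.preimage_isClosed_of_isClosed isClosed_closure isClosed_Ici) inter_subset_left
    have := hp.isH10Pair_truncate (η := fun s => ε n * ζ (s / ε n)) (M := M) hU hucU hK (hεpos n)
      (contDiff_const.mul (hζ.comp (contDiff_id.div_const _)))
      (fun s hs => by
        rw [hζ0 _ (by rw [habs]; exact ((div_lt_one (hεpos n)).2 hs).le), mul_zero])
      (fun s => by rw [hder]; exact hM _)
      (fun s hs => by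
        rw [hder]
        exact hζ' _ (by rw [habs]; exact (div_lt_one (hεpos n)).2 hs))
    simpa only [hder] using this
  -- At a point with u ≠ 0, |u|/ε eventually exceeds 2, where ζ' = 1; at a zero of u, ζ'(0) = 0
  -- throughout.
  have hlim : ∀ x, Tendsto (fun n => deriv ζ (u x / ε n)) atTop
      (𝓝 ((u ⁻¹' {0})ᶜ.indicator (fun _ => 1) x)) := by
    intro x
    by_cases hx : u x = 0
    · have : ∀ n, deriv ζ (u x / ε n) = 0 := fun n => hζ' _ (by simp [hx])
      simp only [this]
      simp [hx]
    · have hx' : x ∈ (u ⁻¹' {0})ᶜ := hx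
      rw [indicator_of_mem hx']
      refine tendsto_const_nhds.congr' ?_
      filter_upwards [hεlim.eventually (gt_mem_nhds (half_pos (abs_pos.2 hx)))] with n hn
      refine (hζ1 _ ?_).symm
      rw [habs, lt_div_iff₀ (hεpos n)]
      linarith
  have hcm : ∀ n, AEStronglyMeasurable (fun x => deriv ζ (u x / ε n)) (volume.restrict U) :=
    fun n => hζc.comp_aestronglyMeasurable
      ((continuous_id.div_const (ε n)).comp_aestronglyMeasurable hum)
  have hDCT := tendsto_eLpNorm_smul_sub hu.memLp_grad hcm (fun n x => hM _)
    (Eventually.of_forall hlim)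
  have hcm0 : AEStronglyMeasurable ((u ⁻¹' {0})ᶜ.indicator fun _ => (1 : ℝ)) (volume.restrict U) :=
    aestronglyMeasurable_of_tendsto_ae atTop hcm (Eventually.of_forall hlim)
  -- The gradients converge to ∇u on {u ≠ 0} extended by 0. This limit need not be compared with ∇u
  -- on {u = 0}, because `IsH10Pair.memH10` accepts any gradient.
  refine (IsH10Pair.of_tendsto htr hu.memLp ?_ ?_ hDCT).memH10 hU
  · refine MemLp.of_le_mul (c := 1) hu.memLp_grad (hcm0.smul hu.memLp_grad.aestronglyMeasurable)
      (Eventually.of_forall fun x => ?_)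
    rw [norm_smul]
    refine mul_le_mul_of_nonneg_right ?_ (norm_nonneg _)
    by_cases hx : x ∈ (u ⁻¹' {0})ᶜ
    · simp [hx]
    · simp [hx]
  · have hfin : volume U < ⊤ := hb.measure_lt_top
    have h1 : ∀ n, eLpNorm ((fun x => ε n * ζ (u x / ε n)) - u) 2 (volume.restrict U) ≤
        volume U ^ ((2 : ENNReal).toReal)⁻¹ * ENNReal.ofReal (2 * ε n) := by
      intro n
      have := eLpNorm_le_of_ae_bound (p := 2) (μ := volume.restrict U)
        (f := (fun x => ε n * ζ (u x / ε n)) - u) (C := 2 * ε n) (Eventually.of_forall fun x => by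
          have h2 : ((fun x => ε n * ζ (u x / ε n)) - u) x =
              ε n * (ζ (u x / ε n) - u x / ε n) := by
            have := (hεpos n).ne'
            simp only [Pi.sub_apply]
            field_simp
          rw [h2, Real.norm_eq_abs, abs_mul, abs_of_pos (hεpos n), mul_comm]
          exact mul_le_mul_of_nonneg_right (hζ2 _) (hεpos n).le)
      simpa using this
    refine tendsto_of_tendsto_of_tendsto_of_le_of_le tendsto_const_nhds ?_ (fun _ => zero_le) h1
    have h3 : Tendsto (fun n => ENNReal.ofReal (2 * ε n)) atTop (𝓝 0) := by
      simpa using ENNReal.tendsto_ofReal (hεlim.const_mul 2)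
    simpa using ENNReal.Tendsto.const_mul h3
      (Or.inr (ENNReal.rpow_lt_top_of_nonneg (by norm_num) hfin.ne).ne)

end VEM

namespace VEM

variable {U : Set Plane} {u : Plane → ℝ} {g : Plane → Plane}

/-! ## Lipschitz functions -/

/-- Extend u to a Lipschitz function on the plane. By Rademacher it is differentiable almost
everywhere with bounded gradient, and integration by parts holds for Lipschitz functions against
test functions. -/
theorem MemH1.of_lipschitzOnWith {C : NNReal} (hU : IsOpen U) (hb : Bornology.IsBounded U)
    (hu : LipschitzOnWith C u U) : MemH1 U u := by
  obtain ⟨F, hF, hEq⟩ := hu.extend_real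
  have hae : F =ᵐ[volume.restrict U] u := by
    filter_upwards [self_mem_ae_restrict hU.measurableSet] with x hx using (hEq hx).symm
  have hfin : IsFiniteMeasure (volume.restrict U) :=
    ⟨by rw [Measure.restrict_apply_univ]; exact hb.measure_lt_top⟩
  have hgn : ∀ x, ‖gradient F x‖ ≤ C := fun x => by
    rw [norm_gradient]; exact norm_fderiv_le_of_lipschitz ℝ hF
  have hgm : Measurable (gradient F) :=
    (InnerProductSpace.toDual ℝ Plane).symm.continuous.measurable.comp (measurable_fderiv ℝ F)
  obtain ⟨B, hB⟩ := (hb.isCompact_closure.image hF.continuous).isBounded.exists_norm_le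
  refine (IsH1Pair.congr (u := F) (g := gradient F) ⟨?_, ?_, fun φ hφ e => ?_⟩ hae
    (ae_eq_refl _)).memH1 hU
  · refine MemLp.of_bound hF.continuous.aestronglyMeasurable B ?_
    filter_upwards [self_mem_ae_restrict hU.measurableSet] with x hx
    exact hB _ (mem_image_of_mem F (subset_closure hx))
  · exact MemLp.of_bound hgm.aestronglyMeasurable C (Eventually.of_forall hgn)
  · obtain ⟨D, hD⟩ := hφ.contDiff_one.lipschitzWith_of_hasCompactSupport hφ.hasCompactSupport
      one_ne_zero
    have key := hF.integral_lineDeriv_mul_eq (μ := volume) hD hφ.hasCompactSupport e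
    rw [setIntegral_eq_integral_of_forall_compl_eq_zero (fun x hx => by
        rw [hφ.gradient_eq_zero hx, inner_zero_left, mul_zero]),
      setIntegral_eq_integral_of_forall_compl_eq_zero (fun x hx => by
        rw [hφ.eq_zero hx, zero_mul])]
    have e1 : ∫ x, φ x * ⟪gradient F x, e⟫ = ∫ x, lineDeriv ℝ F x e * φ x := by
      refine integral_congr_ae ?_
      filter_upwards [hF.ae_differentiableAt (μ := volume)] with x hx
      rw [inner_gradient, hx.lineDeriv_eq_fderiv, mul_comm]
    rw [e1, key, ← integral_neg]
    refine integral_congr_ae (Eventually.of_forall fun x => ?_)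
    simp only [inner_gradient, (hφ.differentiable x).lineDeriv_eq_fderiv, map_neg]
    ring

/-- A continuous function on a convex set that is `C`-Lipschitz on finitely many closed sets
covering it is `C`-Lipschitz. -/
theorem Convex.lipschitzOnWith_of_closed_cover {E ι : Type*} [NormedAddCommGroup E]
    [NormedSpace ℝ E] [Finite ι] {s : Set E} (hs : Convex ℝ s) {f : E → ℝ}
    (hf : ContinuousOn f s) {P : ι → Set E} (hP : ∀ i, IsClosed (P i)) (hsP : s ⊆ ⋃ i, P i)
    {C : NNReal} (hC : ∀ i, LipschitzOnWith C f (P i)) : LipschitzOnWith C f s := by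
  refine LipschitzOnWith.of_le_add_mul C fun y hy x hx => ?_
  set γ : ℝ → E := fun t => AffineMap.lineMap (k := ℝ) x y t with hγ
  have hγc : Continuous γ := AffineMap.lineMap_continuous
  have hγs : ∀ t ∈ Icc (0 : ℝ) 1, γ t ∈ s := fun t ht => hs.lineMap_mem hx hy ht
  have hdist : ∀ a b, dist (γ a) (γ b) = |a - b| * dist x y := fun a b => by
    rw [hγ, dist_lineMap_lineMap, Real.dist_eq]
  -- Continuous induction along the segment from x to y. Just to the right of t < 1 some piece P i
  -- is met arbitrarily close to t; being closed it contains γ(t) too, so its Lipschitz bound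
  -- carries the inequality from t to a later point.
  set S : Set ℝ := {t | f (γ t) ≤ f (γ 0) + C * (t * dist x y)} with hS
  have hcl : IsClosed (S ∩ Icc 0 1) := by
    have h1 : ContinuousOn (fun t => f (γ 0) + C * (t * dist x y) - f (γ t)) (Icc 0 1) :=
      ContinuousOn.sub (by fun_prop) (hf.comp hγc.continuousOn hγs)
    have := h1.preimage_isClosed_of_isClosed isClosed_Icc (isClosed_Ici (a := 0))
    convert this using 1
    ext t
    simp [hS, and_comm]
  have h1 : (1 : ℝ) ∈ S := by
    refine hcl.mem_of_ge_of_forall_exists_gt (by simp [hS]) zero_le_one ?_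
    rintro t ⟨htS, ht0, ht1⟩
    have hev : ∀ᶠ z in 𝓝[>] t, z ∈ Ioc t 1 := Ioc_mem_nhdsGT ht1
    obtain ⟨i, hi⟩ : ∃ i, ∃ᶠ z in 𝓝[>] t, γ z ∈ P i := by
      by_contra hcon
      simp only [not_exists, not_frequently] at hcon
      obtain ⟨z, hz, hz'⟩ := (hev.and (eventually_all.2 hcon)).exists
      obtain ⟨i, hi⟩ := mem_iUnion.1 (hsP (hγs z ⟨ht0.trans hz.1.le, hz.2⟩))
      exact hz' i hi
    have hti : γ t ∈ P i := by
      have h2 : t ∈ closure (γ ⁻¹' P i) :=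
        mem_closure_iff_frequently.2 (hi.filter_mono nhdsWithin_le_nhds)
      rwa [((hP i).preimage hγc).closure_eq] at h2
    obtain ⟨z, hz1, hz⟩ := (hi.and_eventually hev).exists
    refine ⟨z, ?_, hz⟩
    have h3 := (hC i).le_add_mul hz1 hti
    rw [hdist, abs_of_pos (sub_pos.2 hz.1)] at h3
    have h4 : f (γ t) ≤ f (γ 0) + C * (t * dist x y) := htS
    change f (γ z) ≤ f (γ 0) + C * (z * dist x y)
    linarith
  have h5 : f (γ 1) ≤ f (γ 0) + C * (1 * dist x y) := h1
  simpa [hγ, dist_comm] using h5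

/-! ## Linear algebra -/

/-- Precompose J with a linear section of G; the kernel inclusion makes the result independent of
the chosen preimage. -/
theorem exists_comp_rangeRestrict_eq {Z M H : Type*} [AddCommGroup Z] [Module ℝ Z]
    [AddCommGroup M] [Module ℝ M] [AddCommGroup H] [Module ℝ H] (G : Z →ₗ[ℝ] M) (J : Z →ₗ[ℝ] H)
    (h : LinearMap.ker G ≤ LinearMap.ker J) :
    ∃ A : LinearMap.range G →ₗ[ℝ] H, ∀ z, A (G.rangeRestrict z) = J z := by
  obtain ⟨S, hS⟩ := G.rangeRestrict.exists_rightInverse_of_surjective G.range_rangeRestrict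
  refine ⟨J ∘ₗ S, fun z => ?_⟩
  have h1 : G (S (G.rangeRestrict z)) = G z :=
    congrArg Subtype.val (LinearMap.congr_fun hS (G.rangeRestrict z))
  have h2 : S (G.rangeRestrict z) - z ∈ LinearMap.ker J :=
    h (by rw [LinearMap.mem_ker, map_sub, h1, sub_self])
  rw [LinearMap.mem_ker, map_sub, sub_eq_zero] at h2
  exact h2

/-- L₂ factors through the range of L₁, and a linear map on a finite-dimensional normed space is
bounded. This replaces equivalence of norms without requiring L₁ to be injective, which suits
functions identified almost everywhere. -/
theorem exists_le_mul_norm_of_ker_le {W H₁ H₂ : Type*} [AddCommGroup W] [Module ℝ W]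
    [FiniteDimensional ℝ W] [NormedAddCommGroup H₁] [NormedSpace ℝ H₁] [NormedAddCommGroup H₂]
    [NormedSpace ℝ H₂] (L₁ : W →ₗ[ℝ] H₁) (L₂ : W →ₗ[ℝ] H₂)
    (h : LinearMap.ker L₁ ≤ LinearMap.ker L₂) : ∃ C : ℝ, 0 ≤ C ∧ ∀ w, ‖L₂ w‖ ≤ C * ‖L₁ w‖ := by
  obtain ⟨A, hA⟩ := exists_comp_rangeRestrict_eq L₁ L₂ h
  refine ⟨‖LinearMap.toContinuousLinearMap A‖, ContinuousLinearMap.opNorm_nonneg _, fun w => ?_⟩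
  rw [← hA]
  exact (LinearMap.toContinuousLinearMap A).le_opNorm (L₁.rangeRestrict w)

/-- A Riesz representation theorem on the image of a finite-dimensional family. -/
theorem exists_inner_eq_of_ker_le {Z M H : Type*} [AddCommGroup Z] [Module ℝ Z] [AddCommGroup M]
    [Module ℝ M] [FiniteDimensional ℝ M] [NormedAddCommGroup H] [InnerProductSpace ℝ H]
    (J : Z →ₗ[ℝ] H) (G : Z →ₗ[ℝ] M) (ℓ : Z →ₗ[ℝ] ℝ) (hGJ : LinearMap.ker G ≤ LinearMap.ker J)
    (hJℓ : LinearMap.ker J ≤ LinearMap.ker ℓ) : ∃ u, ∀ v, ⟪J u, J v⟫ = ℓ v := by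
  obtain ⟨A, hA⟩ := exists_comp_rangeRestrict_eq G J hGJ
  obtain ⟨B, hB⟩ := exists_comp_rangeRestrict_eq J ℓ hJℓ
  -- J factors through the finite-dimensional range of G, so its own range is finite dimensional,
  -- hence complete, and the Riesz theorem applies there even if H is not complete.
  have hle : LinearMap.range J ≤ LinearMap.range A := by
    rintro _ ⟨z, rfl⟩
    exact ⟨_, hA z⟩
  have hfin : FiniteDimensional ℝ (LinearMap.range J) := Submodule.finiteDimensional_of_le hle
  obtain ⟨⟨_, u, rfl⟩, hr⟩ := (InnerProductSpace.toDual ℝ (LinearMap.range J)).surjective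
    (LinearMap.toContinuousLinearMap B)
  refine ⟨u, fun v => ?_⟩
  have := congrArg (fun F => F (J.rangeRestrict v)) hr
  rw [← hB]
  exact this

end VEM

noncomputable section

namespace VEM

/-! ## Polynomial functions of bounded degree -/

/-- `f` is a polynomial function on the plane of degree at most `k`. -/
def IsPolyFun (k : ℕ) (f : Plane → ℝ) : Prop :=
  ∃ p : MvPolynomial (Fin 2) ℝ, p.totalDegree ≤ k ∧ ∀ x, f x = polyEval p x

section IsPolyFun

variable {k l : ℕ} {f g : Plane → ℝ}

theorem isPolyFun_polyEval {p : MvPolynomial (Fin 2) ℝ} (hp : p.totalDegree ≤ k) :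
    IsPolyFun k (polyEval p) := ⟨p, hp, fun _ => rfl⟩

theorem IsPolyFun.mono (hf : IsPolyFun k f) (hkl : k ≤ l) : IsPolyFun l f := by
  obtain ⟨p, hp, h⟩ := hf
  exact ⟨p, hp.trans hkl, h⟩

theorem isPolyFun_const (k : ℕ) (c : ℝ) : IsPolyFun k (fun _ => c) :=
  ⟨MvPolynomial.C c, by simp, fun x => by simp [polyEval]⟩

theorem IsPolyFun.add (hf : IsPolyFun k f) (hg : IsPolyFun k g) :
    IsPolyFun k (fun x => f x + g x) := by
  obtain ⟨p, hp, h⟩ := hf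
  obtain ⟨q, hq, h'⟩ := hg
  exact ⟨p + q, (MvPolynomial.totalDegree_add p q).trans (max_le hp hq),
    fun x => by simp [polyEval, h, h']⟩

theorem IsPolyFun.mul (hf : IsPolyFun k f) (hg : IsPolyFun l g) :
    IsPolyFun (k + l) (fun x => f x * g x) := by
  obtain ⟨p, hp, h⟩ := hf
  obtain ⟨q, hq, h'⟩ := hg
  exact ⟨p * q, (MvPolynomial.totalDegree_mul p q).trans (add_le_add hp hq),
    fun x => by simp [polyEval, h, h']⟩

theorem IsPolyFun.const_mul (c : ℝ) (hf : IsPolyFun k f) : IsPolyFun k (fun x => c * f x) := by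
  simpa using (isPolyFun_const 0 c).mul hf

theorem IsPolyFun.sub (hf : IsPolyFun k f) (hg : IsPolyFun k g) :
    IsPolyFun k (fun x => f x - g x) := by
  simpa [sub_eq_add_neg] using hf.add (hg.const_mul (-1))

theorem IsPolyFun.pow (hf : IsPolyFun k f) (n : ℕ) : IsPolyFun (n * k) (fun x => f x ^ n) := by
  induction n with
  | zero => simpa using isPolyFun_const (0 * k) 1
  | succ n ih =>
    rw [Nat.succ_mul]
    simpa [pow_succ] using ih.mul hf

theorem IsPolyFun.sum {ι : Type*} (s : Finset ι) {F : ι → Plane → ℝ}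
    (hF : ∀ i ∈ s, IsPolyFun k (F i)) : IsPolyFun k (fun x => ∑ i ∈ s, F i x) := by
  classical
  induction s using Finset.induction_on with
  | empty => simpa using isPolyFun_const k 0
  | insert a s ha ih =>
    simp only [Finset.sum_insert ha]
    exact (hF a (Finset.mem_insert_self a s)).add
      (ih fun i hi => hF i (Finset.mem_insert_of_mem hi))

theorem isPolyFun_affineMap (f : Plane →ᵃ[ℝ] ℝ) : IsPolyFun 1 f := by
  have h1 : ∀ x : Plane, f x = f.linear x + f 0 := fun x => congrFun f.decomp x
  have h2 : ∀ x : Plane, f.linear x = ∑ i, x i * f.linear (EuclideanSpace.single i 1) := by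
    intro x
    conv_lhs => rw [← (EuclideanSpace.basisFun (Fin 2) ℝ).sum_repr x]
    simp
  have h3 : ∀ i : Fin 2, IsPolyFun 1 (fun x : Plane => x i) := fun i =>
    ⟨MvPolynomial.X i, by simp, fun x => by simp [polyEval]⟩
  have h4 : IsPolyFun 1 (fun x : Plane =>
      (∑ i, f.linear (EuclideanSpace.single i 1) * x i) + f 0) :=
    (IsPolyFun.sum _ fun i _ => (h3 i).const_mul _).add (isPolyFun_const 1 _)
  convert h4 using 1
  ext x
  rw [h1, h2]
  simp only [mul_comm]

theorem contDiff_polyEval (p : MvPolynomial (Fin 2) ℝ) : ContDiff ℝ 1 (polyEval p) := by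
  induction p using MvPolynomial.induction_on with
  | C a =>
    have : polyEval (MvPolynomial.C a) = fun _ => a := by ext x; simp [polyEval]
    rw [this]; exact contDiff_const
  | add p q hp hq =>
    have : polyEval (p + q) = fun x => polyEval p x + polyEval q x := by ext x; simp [polyEval]
    rw [this]; exact hp.add hq
  | mul_X p i hp =>
    have : polyEval (p * MvPolynomial.X i) = fun x => polyEval p x * x i := by
      ext x; simp [polyEval]
    rw [this]
    exact hp.mul (by fun_prop)

theorem IsPolyFun.contDiff (hf : IsPolyFun k f) : ContDiff ℝ 1 f := by
  obtain ⟨p, -, h⟩ := hf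
  rw [funext h]
  exact contDiff_polyEval p

theorem IsPolyFun.exists_lipschitzOnWith (hf : IsPolyFun k f) {s : Set Plane}
    (hs : IsCompact s) : ∃ C, LipschitzOnWith C f s :=
  hf.contDiff.locallyLipschitz.locallyLipschitzOn.exists_lipschitzOnWith_of_compact hs

end IsPolyFun

/-! ## Barycentric coordinates -/

/-- The vertices of a triangle, as an affine basis of the plane. -/
def triBasis (T : Triangle) : AffineBasis (Fin 3) ℝ Plane :=
  ⟨T.points, T.independent, by
    rw [T.independent.affineSpan_eq_top_iff_card_eq_finrank_add_one]; simp⟩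

/-- The `i`-th barycentric coordinate. -/
def bary (T : Triangle) (i : Fin 3) : Plane →ᵃ[ℝ] ℝ := (triBasis T).coord i

variable {T : Triangle}

theorem triBasis_apply (T : Triangle) (i : Fin 3) : triBasis T i = T.points i := rfl

theorem range_triBasis (T : Triangle) : range (triBasis T) = range T.points := rfl

theorem bary_points (T : Triangle) (i j : Fin 3) :
    bary T i (T.points j) = if i = j then 1 else 0 := by
  rw [← triBasis_apply]; exact (triBasis T).coord_apply i j

theorem fin_three_ne_add_one : ∀ i : Fin 3, i ≠ i + 1 := by decide

theorem fin_three_ne_add_two : ∀ i : Fin 3, i ≠ i + 2 := by decide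

theorem sum_fin_three_rotate {M : Type*} [AddCommMonoid M] (f : Fin 3 → M) (i : Fin 3) :
    ∑ j, f j = f i + f (i + 1) + f (i + 2) := by
  fin_cases i <;> simp only [Fin.sum_univ_three] <;> simp <;> abel_nf

theorem sum_bary (T : Triangle) (x : Plane) : ∑ i, bary T i x = 1 :=
  (triBasis T).sum_coord_apply_eq_one x

theorem sum_bary_smul (T : Triangle) (x : Plane) : ∑ i, bary T i x • T.points i = x :=
  (triBasis T).linear_combination_coord_eq_self x

theorem continuous_bary (T : Triangle) (i : Fin 3) : Continuous (bary T i) :=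
  (bary T i).continuous_of_finiteDimensional

/-! ### Triangles and their split in barycentric coordinates. -/

theorem mem_closedTri {x : Plane} : x ∈ closedTri T ↔ ∀ i, 0 ≤ bary T i x := by
  rw [closedTri, ← range_triBasis, AffineBasis.convexHull_eq_nonneg_coord]; rfl

theorem mem_openTri {x : Plane} : x ∈ openTri T ↔ ∀ i, 0 < bary T i x := by
  rw [openTri, closedTri, ← range_triBasis, AffineBasis.interior_convexHull]; rfl

theorem isOpen_openTri (T : Triangle) : IsOpen (openTri T) := isOpen_interior

theorem convex_closedTri (T : Triangle) : Convex ℝ (closedTri T) := convex_convexHull ℝ _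

theorem isCompact_closedTri (T : Triangle) : IsCompact (closedTri T) :=
  (finite_range T.points).isCompact_convexHull ℝ

theorem openTri_subset (T : Triangle) : openTri T ⊆ closedTri T := interior_subset

theorem isBounded_openTri (T : Triangle) : Bornology.IsBounded (openTri T) :=
  (isCompact_closedTri T).isBounded.subset (openTri_subset T)

theorem nonempty_openTri (T : Triangle) : (openTri T).Nonempty := by
  rw [openTri, closedTri, interior_convexHull_nonempty_iff_affineSpan_eq_top]
  exact (triBasis T).tot

theorem closure_openTri (T : Triangle) : closure (openTri T) = closedTri T := by
  rw [openTri, (convex_closedTri T).closure_interior_eq_closure_of_nonempty_interior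
    (nonempty_openTri T), (isCompact_closedTri T).isClosed.closure_eq]

theorem frontier_openTri (T : Triangle) : frontier (openTri T) = frontier (closedTri T) := by
  rw [frontier, closure_openTri, (isOpen_openTri T).interior_eq, frontier,
    (isCompact_closedTri T).isClosed.closure_eq, openTri]

theorem frontier_subset_closedTri (T : Triangle) : frontier (closedTri T) ⊆ closedTri T :=
  (isCompact_closedTri T).isClosed.frontier_subset

theorem volume_frontier_closedTri (T : Triangle) : volume (frontier (closedTri T)) = 0 :=
  (convex_closedTri T).addHaar_frontier volume

theorem bary_barycenter (T : Triangle) (i : Fin 3) : bary T i (barycenter T) = 1 / 3 := by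
  have h1 : ∀ x : Plane, bary T i x = (bary T i).linear x + bary T i 0 :=
    fun x => congrFun (bary T i).decomp x
  have h2 : ∑ j, bary T i (T.points j) = 1 := by simp [bary_points]
  rw [barycenter, h1, map_smul, map_sum]
  simp only [h1 (T.points _), Finset.sum_add_distrib] at h2
  simp at h2
  rw [smul_eq_mul, Fin.sum_univ_three] at *
  linarith

/-- The coordinates of x with respect to the subtriangle (barycenter, P_{i+1}, P_{i+2}) are 3λ_i,
λ_{i+1} - λ_i and λ_{i+2} - λ_i. Hence the i-th piece is the part of the triangle where λ_i is the
least coordinate. -/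
theorem mem_hctPiece {i : Fin 3} {x : Plane} :
    x ∈ hctPiece T i ↔ 0 ≤ bary T i x ∧ ∀ j, bary T i x ≤ bary T j x := by
  constructor
  · intro hx
    have hconv : Convex ℝ {x | 0 ≤ bary T i x ∧ ∀ j, bary T i x ≤ bary T j x} := by
      intro x hx y hy a b ha hb hab
      have hc : ∀ j, bary T j (a • x + b • y) = a * bary T j x + b * bary T j y := fun j => by
        simpa using Convex.combo_affine_apply (f := bary T j) (x := x) (y := y) hab
      refine ⟨?_, fun j => ?_⟩
      · rw [hc]; exact add_nonneg (mul_nonneg ha hx.1) (mul_nonneg hb hy.1)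
      · rw [hc, hc]
        exact add_le_add (mul_le_mul_of_nonneg_left (hx.2 j) ha)
          (mul_le_mul_of_nonneg_left (hy.2 j) hb)
    refine convexHull_min ?_ hconv hx
    have n1 := fin_three_ne_add_one i
    have n2 := fin_three_ne_add_two i
    rintro y (rfl | rfl | rfl)
    · exact ⟨by rw [bary_barycenter]; norm_num,
        fun j => by rw [bary_barycenter, bary_barycenter]⟩
    · refine ⟨by rw [bary_points, if_neg n1], fun j => ?_⟩
      rw [bary_points, if_neg n1, bary_points]
      split_ifs <;> norm_num
    · refine ⟨by rw [bary_points, if_neg n2], fun j => ?_⟩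
      rw [bary_points, if_neg n2, bary_points]
      split_ifs <;> norm_num
  · rintro ⟨h0, hj⟩
    have hs := sum_bary T x
    have hx := sum_bary_smul T x
    rw [sum_fin_three_rotate _ i] at hs hx
    have hmem : ∀ y ∈ ({barycenter T, T.points (i + 1), T.points (i + 2)} : Set Plane),
        y ∈ hctPiece T i := fun y hy => subset_convexHull ℝ _ hy
    have key := (convex_convexHull ℝ
      {barycenter T, T.points (i + 1), T.points (i + 2)}).sum_mem (t := Finset.univ)
      (w := ![3 * bary T i x, bary T (i + 1) x - bary T i x, bary T (i + 2) x - bary T i x])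
      (z := ![barycenter T, T.points (i + 1), T.points (i + 2)])
      (fun j _ => by
        fin_cases j
        · simpa using h0
        · simpa using hj (i + 1)
        · simpa using hj (i + 2))
      (by simp [Fin.sum_univ_three]; linarith)
      (fun j _ => by
        fin_cases j
        · exact hmem _ (by simp)
        · exact hmem _ (by simp)
        · exact hmem _ (by simp))
    rw [Fin.sum_univ_three] at key
    simp only [Matrix.cons_val_zero, Matrix.cons_val_one, Matrix.cons_val] at key
    have e : (3 * bary T i x) • barycenter T +
        (bary T (i + 1) x - bary T i x) • T.points (i + 1) +
        (bary T (i + 2) x - bary T i x) • T.points (i + 2) = x := by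
      conv_rhs => rw [← hx]
      rw [barycenter, sum_fin_three_rotate T.points i]
      module
    rw [e] at key
    exact key

theorem isCompact_hctPiece (T : Triangle) (i : Fin 3) : IsCompact (hctPiece T i) := by
  have : ({barycenter T, T.points (i + 1), T.points (i + 2)} : Set Plane).Finite := by simp
  exact this.isCompact_convexHull ℝ

/-- The least barycentric coordinate. -/
def minBary (T : Triangle) (x : Plane) : ℝ :=
  Finset.univ.inf' Finset.univ_nonempty fun i => bary T i x

theorem continuous_minBary (T : Triangle) : Continuous (minBary T) :=
  Continuous.finset_inf'_apply _ fun i _ => continuous_bary T i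

theorem minBary_le (T : Triangle) (x : Plane) (i : Fin 3) : minBary T x ≤ bary T i x :=
  Finset.inf'_le _ (Finset.mem_univ i)

theorem exists_minBary_eq (T : Triangle) (x : Plane) : ∃ i, minBary T x = bary T i x := by
  obtain ⟨i, -, hi⟩ := Finset.exists_mem_eq_inf' Finset.univ_nonempty fun i => bary T i x
  exact ⟨i, hi⟩

theorem minBary_eq_of_mem_hctPiece {i : Fin 3} {x : Plane} (hx : x ∈ hctPiece T i) :
    minBary T x = bary T i x := by
  obtain ⟨j, hj⟩ := exists_minBary_eq T x
  exact le_antisymm (minBary_le T x i) (hj ▸ (mem_hctPiece.1 hx).2 j)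

theorem minBary_pos {x : Plane} (hx : x ∈ openTri T) : 0 < minBary T x := by
  obtain ⟨j, hj⟩ := exists_minBary_eq T x
  rw [hj]
  exact mem_openTri.1 hx j

theorem minBary_of_mem_frontier {x : Plane} (hx : x ∈ frontier (closedTri T)) :
    minBary T x = 0 := by
  have h1 := mem_closedTri.1 (frontier_subset_closedTri T hx)
  obtain ⟨j, hj⟩ := exists_minBary_eq T x
  refine le_antisymm (not_lt.1 fun h => ?_) (hj ▸ h1 j)
  exact hx.2 (mem_openTri.2 fun i => h.trans_le (minBary_le T x i))

theorem exists_mem_hctPiece {x : Plane} (hx : x ∈ closedTri T) : ∃ i, x ∈ hctPiece T i := by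
  obtain ⟨j, hj⟩ := exists_minBary_eq T x
  exact ⟨j, mem_hctPiece.2 ⟨mem_closedTri.1 hx j, fun i => hj ▸ minBary_le T x i⟩⟩

end VEM

end

noncomputable section

namespace VEM

variable {k l : ℕ} {T : Triangle} {v w : Plane → ℝ}

/-! ## Piecewise polynomials on the Hsieh–Clough–Tocher split -/

theorem memHCT_of_isPolyFun (hw : ContinuousOn w (closedTri T))
    (h : ∀ i, ∃ f, IsPolyFun k f ∧ ∀ x ∈ hctPiece T i, w x = f x) : MemHCT k T w := by
  refine ⟨hw, fun i => ?_⟩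
  obtain ⟨f, ⟨p, hp, hf⟩, h⟩ := h i
  exact ⟨p, hp, fun x hx => by rw [h x hx, hf]⟩

theorem MemHCT.exists_isPolyFun (hw : MemHCT k T w) (i : Fin 3) :
    ∃ f, IsPolyFun k f ∧ ∀ x ∈ hctPiece T i, w x = f x := by
  obtain ⟨p, hp, h⟩ := hw.poly i
  exact ⟨polyEval p, isPolyFun_polyEval hp, h⟩

theorem MemHCT.add (hv : MemHCT k T v) (hw : MemHCT k T w) :
    MemHCT k T (fun x => v x + w x) := by
  refine memHCT_of_isPolyFun (hv.continuousOn.add hw.continuousOn) fun i => ?_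
  obtain ⟨f, hf, hvf⟩ := hv.exists_isPolyFun i
  obtain ⟨g, hg, hwg⟩ := hw.exists_isPolyFun i
  exact ⟨_, hf.add hg, fun x hx => by rw [hvf x hx, hwg x hx]⟩

theorem MemHCT.const_mul (c : ℝ) (hw : MemHCT k T w) : MemHCT k T (fun x => c * w x) := by
  refine memHCT_of_isPolyFun (continuousOn_const.mul hw.continuousOn) fun i => ?_
  obtain ⟨g, hg, hwg⟩ := hw.exists_isPolyFun i
  exact ⟨_, hg.const_mul c, fun x hx => by rw [hwg x hx]⟩

theorem MemHCT.sub (hv : MemHCT k T v) (hw : MemHCT k T w) :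
    MemHCT k T (fun x => v x - w x) := by
  simpa [sub_eq_add_neg] using hv.add (hw.const_mul (-1))

theorem MemHCT.zero : MemHCT k T (fun _ => 0) :=
  memHCT_of_isPolyFun continuousOn_const fun _ => ⟨_, isPolyFun_const k 0, fun _ _ => rfl⟩

/-- Each piece is compact and carries a polynomial, hence a Lipschitz bound; continuity across the
pieces and convexity of the triangle make the largest of these bounds global. -/
theorem MemHCT.exists_lipschitzOnWith (hw : MemHCT k T w) :
    ∃ C, LipschitzOnWith C w (closedTri T) := by
  have h : ∀ i, ∃ C, LipschitzOnWith C w (hctPiece T i) := by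
    intro i
    obtain ⟨f, hf, h⟩ := hw.exists_isPolyFun i
    obtain ⟨C, hC⟩ := hf.exists_lipschitzOnWith (isCompact_hctPiece T i)
    exact ⟨C, fun x hx y hy => by rw [h x hx, h y hy]; exact hC hx hy⟩
  choose C hC using h
  refine ⟨Finset.univ.sup C, Convex.lipschitzOnWith_of_closed_cover (convex_closedTri T)
    hw.continuousOn (fun i => (isCompact_hctPiece T i).isClosed)
    (fun x hx => mem_iUnion.2 (exists_mem_hctPiece hx))
    fun i => (hC i).weaken (Finset.le_sup (Finset.mem_univ i))⟩

theorem MemHCT.memH1 (hw : MemHCT k T w) : MemH1 (openTri T) w := by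
  obtain ⟨C, hC⟩ := hw.exists_lipschitzOnWith
  exact MemH1.of_lipschitzOnWith (isOpen_openTri T) (isBounded_openTri T)
    (hC.mono (openTri_subset T))

theorem memH10_openTri_of_eqOn_frontier (hw : MemH1 (openTri T) w)
    (hc : ContinuousOn w (closedTri T)) (h0 : ∀ x ∈ frontier (closedTri T), w x = 0) :
    MemH10 (openTri T) w :=
  hw.memH10_of_eqOn_frontier (isOpen_openTri T) (isBounded_openTri T)
    (by rwa [closure_openTri]) (by rwa [frontier_openTri])

/-- Products of polynomials and the squared bubble function `(min_i λ_i)²`. -/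
theorem memHCT_sq_minBary_mul {f : Plane → ℝ} (hf : IsPolyFun l f) :
    MemHCT (l + 2) T (fun x => minBary T x ^ 2 * f x) := by
  refine memHCT_of_isPolyFun
    (((continuous_minBary T).pow 2).mul hf.contDiff.continuous).continuousOn fun i => ?_
  -- On the i-th piece the minimum is the single affine function λ_i, so its square costs exactly
  -- two degrees.
  refine ⟨_, ((isPolyFun_affineMap (bary T i)).pow 2).mul hf |>.mono (by omega), fun x hx => ?_⟩
  rw [minBary_eq_of_mem_hctPiece hx]

theorem memH10_sq_minBary_mul {f : Plane → ℝ} (hf : IsPolyFun l f) :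
    MemH10 (openTri T) (fun x => minBary T x ^ 2 * f x) :=
  memH10_openTri_of_eqOn_frontier (memHCT_sq_minBary_mul hf).memH1
    (memHCT_sq_minBary_mul hf).continuousOn fun x hx => by
      rw [minBary_of_mem_frontier hx]; ring

/-! ## Extension of boundary data -/

/-- The homogenisation in degree `k` of a polynomial in one variable. -/
def homogenise (k : ℕ) (q : Polynomial ℝ) (a b : ℝ) : ℝ :=
  ∑ j ∈ Finset.range (k + 1), q.coeff j * (b ^ j * (a + b) ^ (k - j))

theorem homogenise_eq_eval {q : Polynomial ℝ} (hq : q.natDegree ≤ k) (t : ℝ) :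
    homogenise k q (1 - t) t = q.eval t := by
  rw [Polynomial.eval_eq_sum_range' (Nat.lt_succ_of_le hq)]
  simp [homogenise]

/-- Along an axis the homogenised polynomial reduces to an end value times a k-th power. This and
the companion for a = 0 let the contributions of the other two edges cancel in
`MemBoundaryPoly.exists_memHCT`. -/
theorem homogenise_zero_right (q : Polynomial ℝ) (a : ℝ) :
    homogenise k q a 0 = q.eval 0 * a ^ k := by
  rw [homogenise, Finset.sum_eq_single 0]
  · simp [Polynomial.coeff_zero_eq_eval_zero]
  · intro j _ hj
    simp [hj]
  · simp

theorem homogenise_zero_left {q : Polynomial ℝ} (hq : q.natDegree ≤ k) (b : ℝ) :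
    homogenise k q 0 b = q.eval 1 * b ^ k := by
  rw [Polynomial.eval_eq_sum_range' (Nat.lt_succ_of_le hq), homogenise, Finset.sum_mul]
  refine Finset.sum_congr rfl fun j hj => ?_
  have : j + (k - j) = k := by have := Finset.mem_range.1 hj; omega
  rw [zero_add, ← pow_add, this, one_pow, mul_one]

theorem continuous_homogenise (q : Polynomial ℝ) :
    Continuous fun p : ℝ × ℝ => homogenise k q p.1 p.2 := by
  unfold homogenise
  fun_prop

theorem IsPolyFun.homogenise {f g : Plane → ℝ} (hf : IsPolyFun 1 f) (hg : IsPolyFun 1 g)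
    (q : Polynomial ℝ) : IsPolyFun k (fun x => homogenise k q (f x) (g x)) := by
  refine IsPolyFun.sum _ fun j hj => ?_
  have := Finset.mem_range.1 hj
  exact (((hg.pow j).mul ((hf.add hg).pow (k - j))).const_mul _).mono (by omega)

theorem exists_lineMap_of_mem_frontier {x : Plane} (hx : x ∈ frontier (closedTri T)) :
    ∃ i, x ∈ hctPiece T i ∧ bary T i x = 0 ∧ bary T (i + 1) x = 1 - bary T (i + 2) x ∧
      bary T (i + 2) x ∈ Icc (0 : ℝ) 1 ∧
      x = AffineMap.lineMap (T.points (i + 1)) (T.points (i + 2)) (bary T (i + 2) x) := by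
  have h1 := mem_closedTri.1 (frontier_subset_closedTri T hx)
  obtain ⟨i, hi⟩ := exists_minBary_eq T x
  rw [minBary_of_mem_frontier hx] at hi
  have hs := sum_bary T x
  have hsm := sum_bary_smul T x
  rw [sum_fin_three_rotate _ i, ← hi, zero_add] at hs
  rw [sum_fin_three_rotate _ i, ← hi, zero_smul, zero_add] at hsm
  have h2 : bary T (i + 1) x = 1 - bary T (i + 2) x := by linarith
  refine ⟨i, mem_hctPiece.2 ⟨hi.le, fun j => hi ▸ h1 j⟩, hi.symm, h2,
    ⟨h1 _, by linarith [h1 (i + 1)]⟩, ?_⟩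
  rw [AffineMap.lineMap_apply_module, ← h2, hsm]

/-- Piecewise polynomial boundary data extend to the Hsieh–Clough–Tocher space. -/
theorem MemBoundaryPoly.exists_memHCT {g : Plane → ℝ} (hk : 1 ≤ k) (hg : MemBoundaryPoly k T g) :
    ∃ w, MemHCT k T w ∧ Continuous w ∧ EqOn w g (frontier (closedTri T)) := by
  choose q hqd hq using hg.poly
  have q0 : ∀ i, (q i).eval 0 = g (T.points (i + 1)) := fun i => by
    rw [← hq i 0 (by simp), AffineMap.lineMap_apply_zero]
  have q1 : ∀ i, (q i).eval 1 = g (T.points (i + 2)) := fun i => by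
    rw [← hq i 1 (by simp), AffineMap.lineMap_apply_one]
  -- On the i-th piece μ_i = 0, while on ∂K the minimum vanishes and μ_j = λ_j.
  set μ : Fin 3 → Plane → ℝ := fun i x => bary T i x - minBary T x with hμ
  have hμc : ∀ i, Continuous (μ i) := fun i => (continuous_bary T i).sub (continuous_minBary T)
  -- One homogenised polynomial per edge, minus a correction per vertex. On the i-th piece, edges i
  -- + 1 and i + 2 contribute only g(P_{i+2})μ_{i+2}^k and g(P_{i+1})μ_{i+1}^k, which the
  -- corrections at these two vertices remove; the correction at vertex i vanishes because k ≥ 1. A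
  -- single global formula makes continuity immediate.
  set w : Plane → ℝ := fun x => ∑ i, (homogenise k (q i) (μ (i + 1) x) (μ (i + 2) x) -
    g (T.points i) * μ i x ^ k) with hw
  have hwc : Continuous w := by
    refine continuous_finsetSum _ fun i _ => Continuous.sub ?_ ?_
    · exact (continuous_homogenise (q i)).comp ((hμc _).prodMk (hμc _))
    · exact continuous_const.mul ((hμc i).pow k)
  have hpiece : ∀ i, ∀ x ∈ hctPiece T i, w x =
      homogenise k (q i) (bary T (i + 1) x - bary T i x) (bary T (i + 2) x - bary T i x) := by
    intro i x hx
    have e1 : i + 1 + 1 = i + 2 := by clear hx; revert i; decide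
    have e2 : i + 1 + 2 = i := by clear hx; revert i; decide
    have e3 : i + 2 + 1 = i := by clear hx; revert i; decide
    have e4 : i + 2 + 2 = i + 1 := by clear hx; revert i; decide
    have h0 : μ i x = 0 := by rw [hμ]; simp only [minBary_eq_of_mem_hctPiece hx, sub_self]
    have h3 : ∀ j, bary T j x - bary T i x = μ j x := fun j => by
      rw [hμ]; simp only [minBary_eq_of_mem_hctPiece hx]
    rw [hw, h3, h3]
    simp only [sum_fin_three_rotate _ i, e1, e2, e3, e4, h0]
    rw [homogenise_zero_right, homogenise_zero_left (hqd _), q0, q1, e1, e4,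
      zero_pow (by omega)]
    ring
  refine ⟨w, memHCT_of_isPolyFun hwc.continuousOn fun i => ⟨_, ?_, hpiece i⟩, hwc, fun x hx => ?_⟩
  · exact ((isPolyFun_affineMap _).sub (isPolyFun_affineMap _)).homogenise
      ((isPolyFun_affineMap _).sub (isPolyFun_affineMap _)) _
  · obtain ⟨i, h1, h2, h3, h4, h5⟩ := exists_lineMap_of_mem_frontier hx
    rw [hpiece i x h1, h2, sub_zero, sub_zero, h3, homogenise_eq_eval (hqd i), ← hq i _ h4, ← h5]

end VEM

end

noncomputable section

namespace VEM

variable {U : Set Plane} {u v w : Plane → ℝ}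

/-! ## The gradient as a linear map -/

/-- The vector space `H¹(U)`. -/
def h1Space (hU : IsOpen U) : Submodule ℝ (Plane → ℝ) where
  carrier := {u | MemH1 U u}
  add_mem' hu hv := MemH1.add hU hu hv
  zero_mem' := (MemH10.zero hU).memH1
  smul_mem' c _ hu := MemH1.const_mul hU c hu

/-- The weak gradient, as a linear map `H¹(U) → L²(U)`. -/
def gradMap (hU : IsOpen U) : h1Space hU →ₗ[ℝ] Lp Plane 2 (volume.restrict U) where
  toFun u := (MemH1.memLp_grad u.2).toLp
  map_add' u v := by
    rw [← MemLp.toLp_add]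
    exact MemLp.toLp_congr _ _ (MemH1.weakGrad_add hU u.2 v.2)
  map_smul' c u := by
    rw [RingHom.id_apply, ← MemLp.toLp_const_smul]
    exact MemLp.toLp_congr _ _ (MemH1.weakGrad_const_mul hU c u.2)

theorem inner_gradMap (hU : IsOpen U) (u v : h1Space hU) :
    ⟪gradMap hU u, gradMap hU v⟫ = dirichlet U u v :=
  inner_toLp (MemH1.memLp_grad u.2) (MemH1.memLp_grad v.2)

theorem dirichlet_self_eq_norm_sq (hU : IsOpen U) (u : h1Space hU) :
    dirichlet U u u = ‖gradMap hU u‖ ^ 2 := by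
  rw [← inner_gradMap hU, real_inner_self_eq_norm_sq]

theorem dirichlet_self_nonneg (U : Set Plane) (u : Plane → ℝ) : 0 ≤ dirichlet U u u :=
  integral_nonneg fun _ => real_inner_self_nonneg

theorem gradMap_congr (hU : IsOpen U) {u v : h1Space hU}
    (h : (u : Plane → ℝ) =ᵐ[volume.restrict U] v) : gradMap hU u = gradMap hU v :=
  MemLp.toLp_congr (MemH1.memLp_grad u.2) (MemH1.memLp_grad v.2)
    (MemH1.weakGrad_congr hU v.2 h.symm)

theorem ae_eq_zero_of_gradMap_eq_zero (hU : IsOpen U) (hb : Bornology.IsBounded U)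
    {u : h1Space hU} (hu : MemH10 U u) (h : gradMap hU u = 0) :
    (u : Plane → ℝ) =ᵐ[volume.restrict U] 0 := by
  refine (hu.isH10Pair hU).ae_eq_zero hb ?_
  have h1 : gradMap hU u =ᵐ[volume.restrict U] weakGrad U u :=
    (MemH1.memLp_grad u.2).coeFn_toLp
  rw [h] at h1
  exact h1.symm.trans (Lp.coeFn_zero _ _ _)

theorem ae_eq_zero_of_dirichlet_self_eq_zero (hU : IsOpen U) (hb : Bornology.IsBounded U)
    (hu : MemH10 U u) (h : dirichlet U u u = 0) : u =ᵐ[volume.restrict U] 0 := by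
  have h1 := dirichlet_self_eq_norm_sq hU ⟨u, hu.memH1⟩
  rw [h] at h1
  exact ae_eq_zero_of_gradMap_eq_zero hU hb (u := ⟨u, hu.memH1⟩) hu
    (norm_eq_zero.1 (pow_eq_zero_iff two_ne_zero |>.1 h1.symm))

theorem dirichlet_congr (hU : IsOpen U) {u' v' : Plane → ℝ} (hu : MemH1 U u) (hv : MemH1 U v)
    (huu : u =ᵐ[volume.restrict U] u') (hvv : v =ᵐ[volume.restrict U] v') :
    dirichlet U u' v' = dirichlet U u v := by
  refine integral_congr_ae ?_
  filter_upwards [hu.weakGrad_congr hU huu, hv.weakGrad_congr hU hvv] with x h1 h2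
  rw [h1, h2]

theorem dirichlet_sub_left (hU : IsOpen U) (hu : MemH1 U u) (hv : MemH1 U v) (hw : MemH1 U w) :
    dirichlet U (fun x => u x - v x) w = dirichlet U u w - dirichlet U v w := by
  let u' : h1Space hU := ⟨u, hu⟩
  let v' : h1Space hU := ⟨v, hv⟩
  let w' : h1Space hU := ⟨w, hw⟩
  have h1 := inner_gradMap hU (u' - v') w'
  rw [map_sub, inner_sub_left, inner_gradMap, inner_gradMap] at h1
  exact h1.symm

theorem MemH1.sub (hU : IsOpen U) (hu : MemH1 U u) (hv : MemH1 U v) :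
    MemH1 U (fun x => u x - v x) :=
  (h1Space hU).sub_mem hu hv

/-! ## The local interpolant -/

variable {k : ℕ} {T : Triangle}

theorem HasTrace.add {g h : Plane → ℝ} (hu : HasTrace T u g) (hv : HasTrace T v h) :
    HasTrace T (fun x => u x + v x) (fun x => g x + h x) := by
  obtain ⟨G, h1, h2, h3, h4⟩ := hu
  obtain ⟨H, h5, h6, h7, h8⟩ := hv
  refine ⟨fun x => G x + H x, h1.add h5, h2.add (isOpen_openTri T) h6,
    fun x hx => congrArg₂ (· + ·) (h3 hx) (h7 hx), ?_⟩
  convert h4.add (isOpen_openTri T) h8 using 1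
  ext x; ring

theorem HasTrace.const_mul {g : Plane → ℝ} (c : ℝ) (hu : HasTrace T u g) :
    HasTrace T (fun x => c * u x) (fun x => c * g x) := by
  obtain ⟨G, h1, h2, h3, h4⟩ := hu
  refine ⟨fun x => c * G x, continuousOn_const.mul h1, h2.const_mul (isOpen_openTri T) c,
    fun x hx => congrArg (c * ·) (h3 hx), ?_⟩
  convert h4.const_mul (isOpen_openTri T) c using 1
  ext x; ring

theorem HasTrace.congr {g h : Plane → ℝ} (hu : HasTrace T u g)
    (hgh : EqOn h g (frontier (closedTri T))) : HasTrace T u h := by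
  obtain ⟨G, h1, h2, h3, h4⟩ := hu
  exact ⟨G, h1, h2, h3.trans hgh.symm, h4⟩

/-- Two H¹ functions continuous on K with the same boundary values differ by an element of H¹₀(K).
So w itself can serve as the extension in the definition of the trace. -/
theorem MemHCT.hasTrace_iff (hw : MemHCT k T w) :
    HasTrace T v w ↔ MemH10 (openTri T) (fun x => v x - w x) := by
  constructor
  · rintro ⟨G, h1, h2, h3, h4⟩
    have h5 : MemH10 (openTri T) (fun x => G x - w x) :=
      memH10_openTri_of_eqOn_frontier (h2.sub (isOpen_openTri T) hw.memH1)
        (h1.sub hw.continuousOn) fun x hx => sub_eq_zero.2 (h3 hx)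
    convert h4.add (isOpen_openTri T) h5 using 1
    ext x; ring
  · exact fun h => ⟨w, hw.continuousOn, hw.memH1, fun _ _ => rfl, h⟩

/-- The elements of `H¹₀(K) ∩ 𝕍_k(K)`, together with their polynomial pieces. -/
def bubbleSpace (k : ℕ) (T : Triangle) : Submodule ℝ (h1Space (isOpen_openTri T) ×
    (Fin 3 → MvPolynomial.restrictTotalDegree (Fin 2) ℝ k)) where
  carrier := {z | MemHCT k T z.1 ∧ MemH10 (openTri T) z.1 ∧
    ∀ i, ∀ x ∈ hctPiece T i, (z.1 : Plane → ℝ) x = polyEval (z.2 i) x}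
  add_mem' := by
    rintro z z' ⟨h1, h2, h3⟩ ⟨h4, h5, h6⟩
    refine ⟨h1.add h4, h2.add (isOpen_openTri T) h5, fun i x hx => ?_⟩
    have := congrArg₂ (· + ·) (h3 i x hx) (h6 i x hx)
    simpa [polyEval] using this
  zero_mem' := ⟨MemHCT.zero, MemH10.zero (isOpen_openTri T), fun i x _ => by simp [polyEval]⟩
  smul_mem' := by
    rintro c z ⟨h1, h2, h3⟩
    refine ⟨h1.const_mul c, h2.const_mul (isOpen_openTri T) c, fun i x hx => ?_⟩
    have := congrArg (c * ·) (h3 i x hx)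
    simpa [polyEval, MvPolynomial.smul_eval] using this

/-- A variational problem on a subspace `S` of `V × M`, where `M` is finite dimensional and
determines the energy, has a solution. -/
theorem exists_mem_inner_eq {V M H : Type*} [AddCommGroup V] [Module ℝ V] [AddCommGroup M]
    [Module ℝ M] [FiniteDimensional ℝ M] [NormedAddCommGroup H] [InnerProductSpace ℝ H]
    (S : Submodule ℝ (V × M)) (A : V →ₗ[ℝ] H) (ℓ : V →ₗ[ℝ] ℝ)
    (hSA : ∀ z ∈ S, z.2 = 0 → A z.1 = 0) (hAℓ : ∀ z ∈ S, A z.1 = 0 → ℓ z.1 = 0) :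
    ∃ z ∈ S, ∀ y ∈ S, ⟪A z.1, A y.1⟫ = ℓ y.1 := by
  obtain ⟨z, hz⟩ := exists_inner_eq_of_ker_le (A ∘ₗ LinearMap.fst ℝ _ _ ∘ₗ S.subtype)
    (LinearMap.snd ℝ _ _ ∘ₗ S.subtype) (ℓ ∘ₗ LinearMap.fst ℝ _ _ ∘ₗ S.subtype)
    (fun z hz => hSA z z.2 hz) (fun z hz => hAℓ z z.2 hz)
  exact ⟨z, z.2, fun y hy => hz ⟨y, hy⟩⟩

/-- The H¹₀ projection of r onto the bubbles. The polynomial pieces provide the finite-dimensional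
parameter: if they all vanish, the function vanishes on the triangle and so does its gradient. -/
theorem exists_mem_bubbleSpace_dirichlet_eq (k : ℕ) (r : h1Space (isOpen_openTri T)) :
    ∃ z ∈ bubbleSpace k T, ∀ y ∈ bubbleSpace k T,
      dirichlet (openTri T) z.1 y.1 = dirichlet (openTri T) r y.1 := by
  have hU := isOpen_openTri T
  obtain ⟨z, hz, hzy⟩ := exists_mem_inner_eq (bubbleSpace k T) (gradMap hU)
    ((innerSL ℝ (gradMap hU r)).toLinearMap ∘ₗ gradMap hU) (by
      rintro z hz hm
      have hz0 : (z.1 : Plane → ℝ) =ᵐ[volume.restrict (openTri T)] (0 : h1Space hU) := by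
        filter_upwards [self_mem_ae_restrict hU.measurableSet] with x hx
        obtain ⟨i, hi⟩ := exists_mem_hctPiece (openTri_subset T hx)
        rw [hz.2.2 i x hi]
        simp [polyEval, hm]
      rw [gradMap_congr hU hz0, map_zero])
    (fun z _ h => by rw [LinearMap.comp_apply, h, map_zero])
  refine ⟨z, hz, fun y hy => ?_⟩
  rw [← inner_gradMap hU, ← inner_gradMap hU]
  exact hzy y hy

/-- Lift the boundary data to some w₀ in 𝕍_k(K), then add the projection onto the bubbles of v - w₀,
which lies in H¹₀(K). -/
theorem exists_isLocalInterpolant (hk : 1 ≤ k) (hv : MemH1 (openTri T) v)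
    (htr : ∃ g, MemBoundaryPoly k T g ∧ HasTrace T v g) : ∃ w, IsLocalInterpolant k T v w := by
  have hU := isOpen_openTri T
  obtain ⟨g, hg, hvg⟩ := htr
  obtain ⟨w₀, hw₀, -, hw₀g⟩ := hg.exists_memHCT hk
  have h1 : HasTrace T v w₀ := hvg.congr hw₀g
  have h2 := hw₀.hasTrace_iff.1 h1
  obtain ⟨z, hz, hzy⟩ := exists_mem_bubbleSpace_dirichlet_eq k
    (⟨fun x => v x - w₀ x, h2.memH1⟩ : h1Space hU)
  have hw : MemHCT k T (fun x => w₀ x + (z.1 : Plane → ℝ) x) := hw₀.add hz.1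
  refine ⟨_, hw, hw.hasTrace_iff.2 ?_, fun y hy hy0 => ?_⟩
  · convert h2.sub hU hz.2.1 using 1
    ext x; ring
  · choose p hp hpy using hy.poly
    have key := hzy (⟨y, hy0.memH1⟩, fun i =>
      ⟨p i, (MvPolynomial.mem_restrictTotalDegree _ _ _).2 (hp i)⟩) ⟨hy, hy0, hpy⟩
    dsimp only at key
    rw [dirichlet_sub_left hU hv hw₀.memH1 hy0.memH1] at key
    have e2 := dirichlet_sub_left hU hw.memH1 hw₀.memH1 hy0.memH1
    simp only [add_sub_cancel_left] at e2
    linarith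

theorem IsLocalInterpolant.sub_memH10 (hw : IsLocalInterpolant k T v w) :
    MemH10 (openTri T) (fun x => v x - w x) :=
  hw.memHCT.hasTrace_iff.1 hw.trace

/-- The difference of two interpolants is an admissible test function, so its energy is zero and
Poincaré applies. -/
theorem IsLocalInterpolant.ae_eq {w' : Plane → ℝ} (hw : IsLocalInterpolant k T v w)
    (hw' : IsLocalInterpolant k T v w') :
    w =ᵐ[volume.restrict (openTri T)] w' := by
  have hU := isOpen_openTri T
  have h1 : MemH10 (openTri T) (fun x => w x - w' x) := by
    convert hw'.sub_memH10.sub hU hw.sub_memH10 using 1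
    ext x; ring
  have h2 : dirichlet (openTri T) (fun x => w x - w' x) (fun x => w x - w' x) = 0 := by
    have hd := hw.memHCT.sub hw'.memHCT
    rw [dirichlet_sub_left hU hw.memHCT.memH1 hw'.memHCT.memH1 h1.memH1,
      hw.dirichlet_eq _ hd h1, hw'.dirichlet_eq _ hd h1, sub_self]
  filter_upwards [ae_eq_zero_of_dirichlet_self_eq_zero hU (isBounded_openTri T) h1 h2] with x hx
  exact sub_eq_zero.1 hx

theorem IsLocalInterpolant.add {v' w' : Plane → ℝ} (hv : MemH1 (openTri T) v)
    (hv' : MemH1 (openTri T) v') (hw : IsLocalInterpolant k T v w)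
    (hw' : IsLocalInterpolant k T v' w') :
    IsLocalInterpolant k T (fun x => v x + v' x) (fun x => w x + w' x) := by
  have hU := isOpen_openTri T
  refine ⟨hw.memHCT.add hw'.memHCT, hw.trace.add hw'.trace, fun z hz hz0 => ?_⟩
  have key : ∀ {a b : Plane → ℝ}, MemH1 (openTri T) a → MemH1 (openTri T) b →
      dirichlet (openTri T) (fun x => a x + b x) z =
        dirichlet (openTri T) a z + dirichlet (openTri T) b z := by
    intro a b ha hb
    have := dirichlet_sub_left hU (ha.add hU hb) hb hz0.memH1
    simp only [add_sub_cancel_right] at this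
    have e : dirichlet (openTri T) (fun x => a x) z = dirichlet (openTri T) a z := rfl
    linarith
  rw [key hv hv', key hw.memHCT.memH1 hw'.memHCT.memH1, hw.dirichlet_eq z hz hz0,
    hw'.dirichlet_eq z hz hz0]

theorem IsLocalInterpolant.const_mul (c : ℝ) (hv : MemH1 (openTri T) v)
    (hw : IsLocalInterpolant k T v w) :
    IsLocalInterpolant k T (fun x => c * v x) (fun x => c * w x) := by
  have hU := isOpen_openTri T
  refine ⟨hw.memHCT.const_mul c, hw.trace.const_mul c, fun z hz hz0 => ?_⟩
  have key : ∀ {a : Plane → ℝ}, MemH1 (openTri T) a →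
      dirichlet (openTri T) (fun x => c * a x) z = c * dirichlet (openTri T) a z := by
    intro a ha
    have h1 := inner_gradMap hU (c • (⟨a, ha⟩ : h1Space hU)) ⟨z, hz0.memH1⟩
    rw [map_smul, inner_smul_left, inner_gradMap, RCLike.conj_to_real] at h1
    exact h1.symm
  rw [key hv, key hw.memHCT.memH1, hw.dirichlet_eq z hz hz0]

/-! ## The local coercivity estimate -/

theorem memLp_of_continuous_of_isBounded {f : Plane → ℝ} (hb : Bornology.IsBounded U)
    (hU : IsOpen U) (hf : Continuous f) : MemLp f 2 (volume.restrict U) := by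
  have hfin : IsFiniteMeasure (volume.restrict U) :=
    ⟨by rw [Measure.restrict_apply_univ]; exact hb.measure_lt_top⟩
  obtain ⟨B, hB⟩ := (hb.isCompact_closure.image hf).isBounded.exists_norm_le
  refine MemLp.of_bound hf.aestronglyMeasurable B ?_
  filter_upwards [self_mem_ae_restrict hU.measurableSet] with x hx
  exact hB _ (mem_image_of_mem f (subset_closure hx))

/-- Multiplication of polynomials by a continuous weight, with values in `L²(U)`. -/
def weightedPolyMap (k : ℕ) (hb : Bornology.IsBounded U) (hU : IsOpen U) {f : Plane → ℝ}
    (hf : Continuous f) :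
    MvPolynomial.restrictTotalDegree (Fin 2) ℝ k →ₗ[ℝ] Lp ℝ 2 (volume.restrict U) where
  toFun p := (memLp_of_continuous_of_isBounded hb hU
    (hf.mul (contDiff_polyEval p).continuous)).toLp
  map_add' p q := by
    rw [← MemLp.toLp_add]
    refine MemLp.toLp_congr _ _ (Eventually.of_forall fun x => ?_)
    simp [polyEval, mul_add]
  map_smul' c p := by
    rw [RingHom.id_apply, ← MemLp.toLp_const_smul]
    refine MemLp.toLp_congr _ _ (Eventually.of_forall fun x => ?_)
    simp [polyEval, mul_left_comm]

theorem coeFn_weightedPolyMap (k : ℕ) (hb : Bornology.IsBounded U) (hU : IsOpen U)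
    {f : Plane → ℝ} (hf : Continuous f) (p : MvPolynomial.restrictTotalDegree (Fin 2) ℝ k) :
    weightedPolyMap k hb hU hf p =ᵐ[volume.restrict U] fun x => f x * polyEval p x :=
  (memLp_of_continuous_of_isBounded hb hU
    (hf.mul (contDiff_polyEval p).continuous)).coeFn_toLp

/-- The bubble functions `(min_i λ_i)² p`, `p` a polynomial. -/
def sqMinBaryMap (k : ℕ) (T : Triangle) :
    MvPolynomial.restrictTotalDegree (Fin 2) ℝ k →ₗ[ℝ] h1Space (isOpen_openTri T) where
  toFun p := ⟨fun x => minBary T x ^ 2 * polyEval p x, (memHCT_sq_minBary_mul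
    (isPolyFun_polyEval ((MvPolynomial.mem_restrictTotalDegree _ _ _).1 p.2))).memH1⟩
  map_add' p q := by
    ext x
    simp [polyEval, mul_add]
  map_smul' c p := by
    ext x
    simp [polyEval, mul_left_comm]

/-- Testing the interpolation identity with (min λ_i)² Δv recovers the size of Δv from ∇w alone;
once Δv is controlled, an energy estimate controls v - w. -/
theorem exists_dirichlet_le_mul_dirichlet_interpolant (k : ℕ) (T : Triangle) :
    ∃ C : ℝ, 0 ≤ C ∧ ∀ v w, MemH1 (openTri T) v → HasPolyLaplacian k (openTri T) v →
      IsLocalInterpolant k T v w →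
      dirichlet (openTri T) v v ≤ C * dirichlet (openTri T) w w := by
  have hU := isOpen_openTri T
  have hb := isBounded_openTri T
  let L₁ := weightedPolyMap (k - 2) hb hU (continuous_minBary T)
  let L₃ := weightedPolyMap (k - 2) hb hU (continuous_const (y := (1 : ℝ)))
  let L₂ := gradMap hU ∘ₗ sqMinBaryMap (k - 2) T
  -- The weight min λ_i is positive in the open triangle, so bp = 0 forces p = 0 almost everywhere.
  -- This is the kernel inclusion behind both constants C₂ and C₃.
  have hker : ∀ p, L₁ p = 0 → polyEval p =ᵐ[volume.restrict (openTri T)] 0 := by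
    intro p hp
    have h1 : L₁ p =ᵐ[volume.restrict (openTri T)] fun x => minBary T x * polyEval p x :=
      coeFn_weightedPolyMap _ _ _ _ p
    rw [hp] at h1
    filter_upwards [h1, Lp.coeFn_zero ℝ 2 (volume.restrict (openTri T)),
      self_mem_ae_restrict hU.measurableSet] with x h2 h3 hx
    rw [h3] at h2
    exact (mul_eq_zero.1 h2.symm).resolve_left (minBary_pos hx).ne'
  obtain ⟨C₂, hC₂, hL₂⟩ := exists_le_mul_norm_of_ker_le L₁ L₂ (fun p hp => by
    have h1 := hker p hp
    have h2 : (sqMinBaryMap (k - 2) T p : Plane → ℝ) =ᵐ[volume.restrict (openTri T)]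
        (0 : h1Space hU) := by
      filter_upwards [h1] with x hx
      change minBary T x ^ 2 * polyEval p x = 0
      rw [hx]
      exact mul_zero _
    have h3 := gradMap_congr hU h2
    rw [map_zero] at h3
    exact h3)
  obtain ⟨C₃, hC₃, hL₃⟩ := exists_le_mul_norm_of_ker_le L₁ L₃ (fun p hp => by
    have h1 := hker p hp
    have h2 : L₃ p =ᵐ[volume.restrict (openTri T)] fun x => 1 * polyEval p x :=
      coeFn_weightedPolyMap _ _ _ _ p
    refine LinearMap.mem_ker.2 (Lp.ext ?_)
    filter_upwards [h1, h2, Lp.coeFn_zero ℝ 2 (volume.restrict (openTri T))] with x h3 h4 h5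
    rw [h4, h3, h5]
    simp)
  obtain ⟨CP, hCP⟩ := exists_poincare_const hb
  -- With b = min λ_i: C₂ bounds ‖∇(b²p)‖ by ‖bp‖, C₃ bounds ‖p‖ by ‖bp‖, and CP is the Poincaré
  -- constant. Of the 2, one unit comes from (∇w, ∇r) and one from the triangle inequality v = r +
  -- w.
  refine ⟨(C₃ * C₂ * CP + 2) ^ 2, by positivity, ?_⟩
  rintro v w hv ⟨p, hpk, hp⟩ hw
  have hpd : p.totalDegree ≤ k - 2 := by
    rcases hpk with rfl | h
    · simp
    · omega
  let P : MvPolynomial.restrictTotalDegree (Fin 2) ℝ (k - 2) :=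
    ⟨p, (MvPolynomial.mem_restrictTotalDegree _ _ _).2 hpd⟩
  have hpL : MemLp (polyEval p) 2 (volume.restrict (openTri T)) :=
    memLp_of_continuous_of_isBounded hb hU (contDiff_polyEval p).continuous
  -- The distributional equation Δv = p extends by density from test functions to all of H¹₀(K).
  have hortho : ∀ s, MemH10 (openTri T) s →
      dirichlet (openTri T) v s = -∫ x in openTri T, polyEval p x * s x := by
    intro s hs
    have := (hs.isH10Pair hU).integral_eq_zero hv.memLp_grad hpL (fun φ hφ => by
      rw [← hp φ hφ]; ring)
    rw [dirichlet]
    linarith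
  let v' : h1Space hU := ⟨v, hv⟩
  let w' : h1Space hU := ⟨w, hw.memHCT.memH1⟩
  have hr := hw.sub_memH10
  let r : h1Space hU := ⟨fun x => v x - w x, hr.memH1⟩
  have hrvw : r = v' - w' := rfl
  set D := ‖gradMap hU w'‖ with hD
  have hD0 : 0 ≤ D := norm_nonneg _
  have hz0 : MemH10 (openTri T) (fun x => minBary T x ^ 2 * polyEval p x) :=
    memH10_sq_minBary_mul (isPolyFun_polyEval le_rfl)
  -- For k = 1 the truncated k - 2 is 0 and b² has degree 2 > k, but then p = 0. Otherwise k - 2 + 2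
  -- = k.
  have hzk : MemHCT k T (fun x => minBary T x ^ 2 * polyEval p x) := by
    rcases hpk with rfl | h
    · have : (fun x => minBary T x ^ 2 * polyEval 0 x) = fun _ => 0 := by
        ext x; simp [polyEval]
      rw [this]
      exact MemHCT.zero
    · have h1 : MemHCT (k - 2 + 2) T (fun x => minBary T x ^ 2 * polyEval p x) :=
        memHCT_sq_minBary_mul (isPolyFun_polyEval hpd)
      have h3 : k - 2 + 2 = k := by omega
      rwa [h3] at h1
  -- -(∇w, ∇(b²p)) = ‖bp‖², and the left side is at most D·C₂‖bp‖; divide by ‖bp‖ unless it is zero.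
  have step1 : ‖L₁ P‖ ≤ C₂ * D := by
    have h1 : ‖L₁ P‖ ^ 2 = -dirichlet (openTri T) w (fun x => minBary T x ^ 2 * polyEval p x) := by
      rw [hw.dirichlet_eq _ hzk hz0, hortho _ hz0, neg_neg, ← real_inner_self_eq_norm_sq]
      have hm : MemLp (fun x => minBary T x * polyEval p x) 2 (volume.restrict (openTri T)) :=
        memLp_of_continuous_of_isBounded hb hU
          ((continuous_minBary T).mul (contDiff_polyEval p).continuous)
      refine (inner_toLp hm hm).trans (integral_congr_ae (Eventually.of_forall fun x => ?_))
      simp only [real_inner_eq_mul]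
      ring
    have h2 : -dirichlet (openTri T) w (fun x => minBary T x ^ 2 * polyEval p x) ≤
        D * ‖L₂ P‖ := by
      have h3 := inner_gradMap hU w' (sqMinBaryMap (k - 2) T P)
      have h4 := abs_real_inner_le_norm (gradMap hU w') (gradMap hU (sqMinBaryMap (k - 2) T P))
      rw [h3] at h4
      exact (neg_le_abs _).trans h4
    have h5 := hL₂ P
    rcases (norm_nonneg (L₁ P)).eq_or_lt with h6 | h6
    · rw [← h6]; positivity
    · refine le_of_mul_le_mul_right ?_ h6
      calc ‖L₁ P‖ * ‖L₁ P‖ = ‖L₁ P‖ ^ 2 := (sq _).symm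
        _ ≤ D * ‖L₂ P‖ := h1.trans_le h2
        _ ≤ D * (C₂ * ‖L₁ P‖) := mul_le_mul_of_nonneg_left h5 hD0
        _ = C₂ * D * ‖L₁ P‖ := by ring
  -- The energy identity ‖∇r‖² = -(p, r) - (∇w, ∇r), with p bounded by the previous step and r by
  -- Poincaré; divide by ‖∇r‖ unless it is zero.
  have step2 : ‖gradMap hU r‖ ≤ (C₃ * C₂ * CP + 1) * D := by
    have h1 : ‖gradMap hU r‖ ^ 2 = -⟪hpL.toLp, hr.memH1.memLp.toLp⟫ -
        ⟪gradMap hU w', gradMap hU r⟫ := by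
      have h2 : ⟪gradMap hU v', gradMap hU r⟫ = -⟪hpL.toLp, hr.memH1.memLp.toLp⟫ := by
        rw [inner_gradMap, inner_toLp]
        simp only [real_inner_eq_mul]
        exact hortho _ hr
      rw [← h2, ← inner_sub_left, ← map_sub, ← hrvw, real_inner_self_eq_norm_sq]
    have h3 : ‖hpL.toLp‖ ≤ C₃ * (C₂ * D) := by
      have h4 : hpL.toLp = L₃ P :=
        MemLp.toLp_congr hpL (memLp_of_continuous_of_isBounded hb hU
          (continuous_const.mul (contDiff_polyEval P.1).continuous))
          (Eventually.of_forall fun x => (one_mul (polyEval p x)).symm)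
      rw [h4]
      exact (hL₃ P).trans (mul_le_mul_of_nonneg_left step1 hC₃)
    have h5 : ‖hr.memH1.memLp.toLp‖ ≤ CP * ‖gradMap hU r‖ :=
      hCP _ _ (hr.isH10Pair hU) _ hr.memH1.memLp_grad
    have h6 := abs_real_inner_le_norm hpL.toLp hr.memH1.memLp.toLp
    have h7 := abs_real_inner_le_norm (gradMap hU w') (gradMap hU r)
    rcases (norm_nonneg (gradMap hU r)).eq_or_lt with h8 | h8
    · rw [← h8]; positivity
    · refine le_of_mul_le_mul_right ?_ h8
      have h9 : ‖hpL.toLp‖ * ‖hr.memH1.memLp.toLp‖ ≤ C₃ * (C₂ * D) * (CP * ‖gradMap hU r‖) :=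
        mul_le_mul h3 h5 (norm_nonneg _) (by positivity)
      have h10 := neg_le_abs ⟪hpL.toLp, hr.memH1.memLp.toLp⟫
      have h11 := neg_le_abs ⟪gradMap hU w', gradMap hU r⟫
      nlinarith
  have step3 : ‖gradMap hU v'‖ ≤ (C₃ * C₂ * CP + 2) * D := by
    have h1 : gradMap hU v' = gradMap hU r + gradMap hU w' := by
      rw [← map_add, hrvw, sub_add_cancel]
    rw [h1]
    refine (norm_add_le _ _).trans ?_
    linarith
  have h1 := dirichlet_self_eq_norm_sq hU v'
  have h2 := dirichlet_self_eq_norm_sq hU w'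
  calc dirichlet (openTri T) v v = ‖gradMap hU v'‖ ^ 2 := h1
    _ ≤ ((C₃ * C₂ * CP + 2) * D) ^ 2 := pow_le_pow_left₀ (norm_nonneg _) step3 2
    _ = (C₃ * C₂ * CP + 2) ^ 2 * D ^ 2 := mul_pow _ _ _
    _ = _ := by rw [hD, ← h2]

end VEM

end

noncomputable section

namespace VEM

variable {k : ℕ} {Ω U : Set Plane} {𝒯 : Finset Triangle} {T : Triangle} {u v w : Plane → ℝ}

/-! ## The mesh -/

theorem IsTriangularMesh.isBounded (h : IsTriangularMesh Ω 𝒯) : Bornology.IsBounded Ω := by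
  have : IsCompact (closure Ω) := by
    rw [← h.iUnion_eq]
    exact 𝒯.isCompact_biUnion fun T _ => isCompact_closedTri T
  exact this.isBounded.subset subset_closure

/-- Points of Ω outside all open triangles lie on the boundary of some triangle, and boundaries of
convex sets are null. -/
theorem IsTriangularMesh.restrict_iUnion_eq (h : IsTriangularMesh Ω 𝒯) :
    volume.restrict (⋃ T ∈ 𝒯, openTri T) = volume.restrict Ω := by
  refine Measure.restrict_congr_set ?_
  have h1 : (⋃ T ∈ 𝒯, openTri T) ⊆ Ω := iUnion₂_subset h.openTri_subset
  refine h1.eventuallyLE.antisymm (ae_le_set.2 ?_)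
  have h2 : Ω \ (⋃ T ∈ 𝒯, openTri T) ⊆ ⋃ T ∈ 𝒯, frontier (closedTri T) := by
    rintro x ⟨hx, hx'⟩
    have h3 : x ∈ ⋃ T ∈ 𝒯, closedTri T := h.iUnion_eq ▸ subset_closure hx
    simp only [mem_iUnion, exists_prop, not_exists, not_and] at h3 hx' ⊢
    obtain ⟨T, hT, hxT⟩ := h3
    exact ⟨T, hT, subset_closure hxT, hx' T hT⟩
  exact measure_mono_null h2 ((measure_biUnion_null_iff 𝒯.countable_toSet).2 fun T _ =>
    volume_frontier_closedTri T)

theorem IsTriangularMesh.ae_restrict_iff (h : IsTriangularMesh Ω 𝒯) {p : Plane → Prop} :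
    (∀ᵐ x ∂volume.restrict Ω, p x) ↔ ∀ T ∈ 𝒯, ∀ᵐ x ∂volume.restrict (openTri T), p x := by
  rw [← h.restrict_iUnion_eq]
  exact ae_restrict_biUnion_finset_iff _ _ _

theorem IsTriangularMesh.ae_restrict_of_forall_mem (h : IsTriangularMesh Ω 𝒯) {p : Plane → Prop}
    (hp : ∀ T ∈ 𝒯, ∀ x ∈ openTri T, p x) : ∀ᵐ x ∂volume.restrict Ω, p x :=
  h.ae_restrict_iff.2 fun T hT =>
    MeasureTheory.ae_restrict_of_forall_mem (isOpen_openTri T).measurableSet (hp T hT)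

theorem IsTriangularMesh.sum_indicator (h : IsTriangularMesh Ω 𝒯) (f : Triangle → Plane → ℝ)
    (hT : T ∈ 𝒯) {x : Plane} (hx : x ∈ openTri T) :
    ∑ T' ∈ 𝒯, (openTri T').indicator (f T') x = f T x := by
  rw [Finset.sum_eq_single_of_mem T hT, indicator_of_mem hx]
  intro T' hT' hne
  exact indicator_of_notMem (fun hx' => (h.disjoint T' hT' T hT hne).le_bot ⟨hx', hx⟩) _

/-- The weak gradient on Ω restricts to the one on each triangle, so for functions in H¹(Ω) the
broken form is not really broken. -/
theorem IsTriangularMesh.dirichlet_eq (h : IsTriangularMesh Ω 𝒯)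
    (hu : MemH1 Ω u) (hv : MemH1 Ω v) : dirichlet Ω u v = brokenDirichlet 𝒯 u v := by
  have hi : Integrable (fun x => ⟪weakGrad Ω u x, weakGrad Ω v x⟫) (volume.restrict Ω) :=
    integrable_inner_of_memLp_two hu.memLp_grad hv.memLp_grad
  rw [dirichlet, ← h.restrict_iUnion_eq, integral_biUnion_finset _
    (fun T _ => (isOpen_openTri T).measurableSet) (fun T hT T' hT' => h.disjoint T hT T' hT')
    (fun T hT => IntegrableOn.mono_set hi (h.openTri_subset T hT)), brokenDirichlet]
  refine Finset.sum_congr rfl fun T hT => integral_congr_ae ?_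
  filter_upwards [hu.weakGrad_mono (isOpen_openTri T) (h.openTri_subset T hT),
    hv.weakGrad_mono (isOpen_openTri T) (h.openTri_subset T hT)] with x h1 h2
  rw [h1, h2]

/-! ## The virtual element space -/

theorem MemBoundaryPoly.add {g g' : Plane → ℝ} (hg : MemBoundaryPoly k T g)
    (hg' : MemBoundaryPoly k T g') : MemBoundaryPoly k T (fun x => g x + g' x) := by
  refine ⟨hg.continuousOn.add hg'.continuousOn, fun i => ?_⟩
  obtain ⟨q, hq, h1⟩ := hg.poly i
  obtain ⟨q', hq', h2⟩ := hg'.poly i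
  refine ⟨q + q', Polynomial.natDegree_add_le_of_degree_le hq hq', fun t ht => ?_⟩
  rw [h1 t ht, h2 t ht, Polynomial.eval_add]

theorem MemBoundaryPoly.const_mul {g : Plane → ℝ} (c : ℝ) (hg : MemBoundaryPoly k T g) :
    MemBoundaryPoly k T (fun x => c * g x) := by
  refine ⟨continuousOn_const.mul hg.continuousOn, fun i => ?_⟩
  obtain ⟨q, hq, h1⟩ := hg.poly i
  refine ⟨Polynomial.C c * q, (Polynomial.natDegree_C_mul_le _ _).trans hq, fun t ht => ?_⟩
  rw [h1 t ht, Polynomial.eval_mul, Polynomial.eval_C]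

theorem HasPolyLaplacian.add (hU : IsOpen U) (hb : Bornology.IsBounded U) (hu : MemH1 U u)
    (hv : MemH1 U v) (h1 : HasPolyLaplacian k U u) (h2 : HasPolyLaplacian k U v) :
    HasPolyLaplacian k U (fun x => u x + v x) := by
  obtain ⟨p, hp, hpu⟩ := h1
  obtain ⟨q, hq, hqv⟩ := h2
  refine ⟨p + q, ?_, fun φ hφ => ?_⟩
  · rcases hp with rfl | hp
    · rwa [zero_add]
    rcases hq with rfl | hq
    · rw [add_zero]; exact .inr hp
    have := MvPolynomial.totalDegree_add p q
    exact .inr (by omega)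
  · have hφ1 := hφ.memLp_gradient (volume.restrict U) 2
    have hφ2 := hφ.memLp (volume.restrict U) 2
    have h3 : ∫ x in U, ⟪weakGrad U (fun x => u x + v x) x, gradient φ x⟫ =
        (∫ x in U, ⟪weakGrad U u x, gradient φ x⟫) + ∫ x in U, ⟪weakGrad U v x, gradient φ x⟫ := by
      rw [← integral_add (integrable_inner_of_memLp_two hu.memLp_grad hφ1)
        (integrable_inner_of_memLp_two hv.memLp_grad hφ1)]
      refine integral_congr_ae ?_
      filter_upwards [hu.weakGrad_add hU hv] with x hx
      rw [hx, inner_add_left]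
    have hP : ∀ p : MvPolynomial (Fin 2) ℝ, Integrable (fun x => polyEval p x * φ x)
        (volume.restrict U) := fun p => integrable_mul_of_memLp_two
      (memLp_of_continuous_of_isBounded hb hU (contDiff_polyEval p).continuous) hφ2
    have h4 : ∫ x in U, polyEval (p + q) x * φ x =
        (∫ x in U, polyEval p x * φ x) + ∫ x in U, polyEval q x * φ x := by
      rw [← integral_add (hP p) (hP q)]
      refine integral_congr_ae (Eventually.of_forall fun x => ?_)
      simp [polyEval, add_mul]
    rw [h3, h4, ← hpu φ hφ, ← hqv φ hφ]
    ring

theorem HasPolyLaplacian.const_mul (hU : IsOpen U) (c : ℝ) (hu : MemH1 U u)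
    (h : HasPolyLaplacian k U u) : HasPolyLaplacian k U (fun x => c * u x) := by
  obtain ⟨p, hp, hpu⟩ := h
  refine ⟨c • p, ?_, fun φ hφ => ?_⟩
  · rcases hp with rfl | hp
    · exact .inl (smul_zero c)
    have := MvPolynomial.totalDegree_smul_le c p
    exact .inr (by omega)
  · have h3 : ∫ x in U, ⟪weakGrad U (fun x => c * u x) x, gradient φ x⟫ =
        c * ∫ x in U, ⟪weakGrad U u x, gradient φ x⟫ := by
      rw [← integral_const_mul]
      refine integral_congr_ae ?_
      filter_upwards [hu.weakGrad_const_mul hU c] with x hx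
      rw [hx, real_inner_smul_left]
    have h4 : ∫ x in U, polyEval (c • p) x * φ x = c * ∫ x in U, polyEval p x * φ x := by
      rw [← integral_const_mul]
      refine integral_congr_ae (Eventually.of_forall fun x => ?_)
      simp [polyEval, mul_assoc]
    rw [h3, h4, ← hpu φ hφ]
    ring

theorem MemVirtual.memH1_openTri (h : IsTriangularMesh Ω 𝒯) (hv : MemVirtual k Ω 𝒯 v)
    (hT : T ∈ 𝒯) : MemH1 (openTri T) v :=
  hv.memH10.memH1.mono (isOpen_openTri T) (h.openTri_subset T hT)

theorem MemVirtual.add (hΩ : IsOpen Ω) (h : IsTriangularMesh Ω 𝒯) (hu : MemVirtual k Ω 𝒯 u)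
    (hv : MemVirtual k Ω 𝒯 v) : MemVirtual k Ω 𝒯 (fun x => u x + v x) := by
  refine ⟨hu.memH10.add hΩ hv.memH10, fun T hT => ?_, fun T hT => ?_⟩
  · obtain ⟨g, h1, h2⟩ := hu.trace T hT
    obtain ⟨g', h3, h4⟩ := hv.trace T hT
    exact ⟨_, h1.add h3, h2.add h4⟩
  · exact (hu.laplacian T hT).add (isOpen_openTri T) (isBounded_openTri T)
      (hu.memH1_openTri h hT) (hv.memH1_openTri h hT) (hv.laplacian T hT)

theorem MemVirtual.const_mul (hΩ : IsOpen Ω) (h : IsTriangularMesh Ω 𝒯) (c : ℝ)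
    (hu : MemVirtual k Ω 𝒯 u) : MemVirtual k Ω 𝒯 (fun x => c * u x) := by
  refine ⟨hu.memH10.const_mul hΩ c, fun T hT => ?_, fun T hT => ?_⟩
  · obtain ⟨g, h1, h2⟩ := hu.trace T hT
    exact ⟨_, h1.const_mul c, h2.const_mul c⟩
  · exact (hu.laplacian T hT).const_mul (isOpen_openTri T) c (hu.memH1_openTri h hT)

theorem MemVirtual.zero (hΩ : IsOpen Ω) : MemVirtual k Ω 𝒯 (fun _ => 0) := by
  refine ⟨MemH10.zero hΩ, fun T _ => ⟨fun _ => 0, ⟨continuousOn_const, fun i => ⟨0, by simp⟩⟩, ?_⟩,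
    fun T _ => ⟨0, .inl rfl, fun φ hφ => ?_⟩⟩
  · refine (MemHCT.zero (k := 0)).hasTrace_iff.2 ?_
    simpa using MemH10.zero (isOpen_openTri T)
  · have hU := isOpen_openTri T
    have h1 : weakGrad (openTri T) (fun _ => 0) =ᵐ[volume.restrict (openTri T)] fun _ => 0 :=
      (IsH10Pair.zero.isH1Pair).weakGrad_ae_eq hU
    have h2 : ∫ x in openTri T, ⟪weakGrad (openTri T) (fun _ => 0) x, gradient φ x⟫ = 0 := by
      refine integral_eq_zero_of_ae ?_
      filter_upwards [h1] with x hx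
      rw [hx, inner_zero_left]; rfl
    rw [h2]
    simp [polyEval]

/-! ## The interpolant -/

theorem IsInterpolant.add {vh uh : Plane → ℝ} (h : IsTriangularMesh Ω 𝒯)
    (hu : MemVirtual k Ω 𝒯 u) (hv : MemVirtual k Ω 𝒯 v) (huh : IsInterpolant k 𝒯 u uh)
    (hvh : IsInterpolant k 𝒯 v vh) :
    IsInterpolant k 𝒯 (fun x => u x + v x) (fun x => uh x + vh x) := by
  intro T hT
  obtain ⟨w, hw, h1⟩ := huh T hT
  obtain ⟨w', hw', h2⟩ := hvh T hT
  exact ⟨_, hw.add (hu.memH1_openTri h hT) (hv.memH1_openTri h hT) hw',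
    fun x hx => congrArg₂ (· + ·) (h1 hx) (h2 hx)⟩

theorem IsInterpolant.const_mul {uh : Plane → ℝ} (h : IsTriangularMesh Ω 𝒯) (c : ℝ)
    (hu : MemVirtual k Ω 𝒯 u) (huh : IsInterpolant k 𝒯 u uh) :
    IsInterpolant k 𝒯 (fun x => c * u x) (fun x => c * uh x) := by
  intro T hT
  obtain ⟨w, hw, h1⟩ := huh T hT
  exact ⟨_, hw.const_mul c (hu.memH1_openTri h hT), fun x hx => congrArg (c * ·) (h1 hx)⟩

theorem IsInterpolant.zero : IsInterpolant k 𝒯 (fun _ => 0) (fun _ => 0) := by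
  refine fun T _ => ⟨fun _ => 0, ⟨MemHCT.zero, ?_, fun _ _ _ => rfl⟩, fun _ _ => rfl⟩
  refine (MemHCT.zero (k := k)).hasTrace_iff.2 ?_
  simpa using MemH10.zero (isOpen_openTri T)

theorem exists_isInterpolant (hk : 1 ≤ k) (h : IsTriangularMesh Ω 𝒯)
    (hv : MemVirtual k Ω 𝒯 v) : ∃ vh, IsInterpolant k 𝒯 v vh := by
  have h1 : ∀ T ∈ 𝒯, ∃ w, IsLocalInterpolant k T v w := fun T hT =>
    exists_isLocalInterpolant hk (hv.memH1_openTri h hT) (hv.trace T hT)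
  choose! w hw using h1
  exact ⟨fun x => ∑ T ∈ 𝒯, (openTri T).indicator (w T) x, fun T hT =>
    ⟨w T, hw T hT, fun x hx => h.sum_indicator w hT hx⟩⟩

/-- On each triangle v - v_h lies in H¹₀(K), and zero extension preserves H¹₀. Hence v_h equals v
minus a finite sum of elements of H¹₀(Ω) almost everywhere, with no matching of traces across edges.
-/
theorem IsInterpolant.memH10 {vh : Plane → ℝ} (hΩ : IsOpen Ω) (h : IsTriangularMesh Ω 𝒯)
    (hv : MemH10 Ω v) (hvh : IsInterpolant k 𝒯 v vh) : MemH10 Ω vh := by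
  choose! w hw hvw using hvh
  refine (hv.sub hΩ (MemH10.sum hΩ 𝒯 fun T hT => MemH10.indicator hΩ (isOpen_openTri T)
    (h.openTri_subset T hT) (hw T hT).sub_memH10)).congr hΩ ?_
  refine h.ae_restrict_of_forall_mem fun T hT x hx => ?_
  beta_reduce
  rw [h.sum_indicator (fun T y => v y - w T y) hT hx, hvw T hT hx, sub_sub_cancel]

theorem IsInterpolant.ae_eq {vh vh' : Plane → ℝ} (h : IsTriangularMesh Ω 𝒯)
    (hvh : IsInterpolant k 𝒯 v vh) (hvh' : IsInterpolant k 𝒯 v vh') :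
    vh =ᵐ[volume.restrict Ω] vh' := by
  refine h.ae_restrict_iff.2 fun T hT => ?_
  obtain ⟨w, hw, h1⟩ := hvh T hT
  obtain ⟨w', hw', h2⟩ := hvh' T hT
  filter_upwards [hw.ae_eq hw', self_mem_ae_restrict (isOpen_openTri T).measurableSet]
    with x h3 hx
  rw [h1 hx, h2 hx, h3]

/-- The stabilizer-free bilinear form is coercive on the virtual element space. -/
theorem exists_dirichlet_le_mul_brokenDirichlet (k : ℕ) (h : IsTriangularMesh Ω 𝒯) :
    ∃ C : ℝ, 0 < C ∧ ∀ v vh, MemVirtual k Ω 𝒯 v → IsInterpolant k 𝒯 v vh →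
      dirichlet Ω v v ≤ C * brokenDirichlet 𝒯 vh vh := by
  choose C hC hCT using exists_dirichlet_le_mul_dirichlet_interpolant k
  have hsum : 0 ≤ ∑ T ∈ 𝒯, C T := Finset.sum_nonneg fun T _ => hC T
  -- The sum dominates every local constant; the added 1 keeps the bound positive even if all of
  -- them vanish or the mesh is empty.
  refine ⟨∑ T ∈ 𝒯, C T + 1, by positivity, fun v vh hv hvh => ?_⟩
  rw [h.dirichlet_eq hv.memH10.memH1 hv.memH10.memH1, brokenDirichlet, brokenDirichlet,
    Finset.mul_sum]
  refine Finset.sum_le_sum fun T hT => ?_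
  obtain ⟨w, hw, hvw⟩ := hvh T hT
  have hU := isOpen_openTri T
  have h1 : w =ᵐ[volume.restrict (openTri T)] vh :=
    ae_restrict_of_forall_mem hU.measurableSet fun x hx => (hvw hx).symm
  rw [dirichlet_congr hU hw.memHCT.memH1 hw.memHCT.memH1 h1 h1]
  refine (hCT T v w (hv.memH1_openTri h hT) (hv.laplacian T hT) hw).trans ?_
  refine mul_le_mul_of_nonneg_right ?_ (dirichlet_self_nonneg _ _)
  exact (Finset.single_le_sum (fun T _ => hC T) hT).trans (by linarith)

/-! ## The virtual element equation -/

/-- The pairs `(v, Π_h^∇ v)`, `v ∈ Ṽ_h`, together with the polynomial pieces of `Π_h^∇ v`. -/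
def interpolantSpace (k : ℕ) (hΩ : IsOpen Ω) (h : IsTriangularMesh Ω 𝒯) :
    Submodule ℝ (((Plane → ℝ) × h1Space hΩ) ×
      (𝒯 → Fin 3 → MvPolynomial.restrictTotalDegree (Fin 2) ℝ k)) where
  carrier := {z | MemVirtual k Ω 𝒯 z.1.1 ∧ IsInterpolant k 𝒯 z.1.1 z.1.2 ∧
    ∀ (T : 𝒯) (i : Fin 3), ∀ x ∈ openTri T.1 ∩ hctPiece T.1 i,
      (z.1.2 : Plane → ℝ) x = polyEval (z.2 T i) x}
  add_mem' := by
    rintro z z' ⟨h1, h2, h3⟩ ⟨h4, h5, h6⟩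
    refine ⟨h1.add hΩ h h4, h2.add h h1 h4 h5, fun T i x hx => ?_⟩
    have := congrArg₂ (· + ·) (h3 T i x hx) (h6 T i x hx)
    simpa [polyEval] using this
  zero_mem' := ⟨MemVirtual.zero hΩ, IsInterpolant.zero, fun T i x _ => by simp [polyEval]⟩
  smul_mem' := by
    rintro c z ⟨h1, h2, h3⟩
    refine ⟨h1.const_mul hΩ h c, h2.const_mul h c h1, fun T i x hx => ?_⟩
    have := congrArg (c * ·) (h3 T i x hx)
    simpa [polyEval, MvPolynomial.smul_eval] using this

theorem IsInterpolant.exists_mem_interpolantSpace {vh : Plane → ℝ} (hΩ : IsOpen Ω)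
    (h : IsTriangularMesh Ω 𝒯) (hv : MemVirtual k Ω 𝒯 v) (hvh : IsInterpolant k 𝒯 v vh)
    (h1 : MemH1 Ω vh) : ∃ m, ((v, ⟨vh, h1⟩), m) ∈ interpolantSpace k hΩ h := by
  have h2 : ∀ (T : 𝒯) (i : Fin 3), ∃ p : MvPolynomial.restrictTotalDegree (Fin 2) ℝ k,
      ∀ x ∈ openTri T.1 ∩ hctPiece T.1 i, vh x = polyEval p x := by
    intro T i
    obtain ⟨w, hw, hvw⟩ := hvh T T.2
    obtain ⟨p, hp, hpw⟩ := hw.memHCT.poly i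
    exact ⟨⟨p, (MvPolynomial.mem_restrictTotalDegree _ _ _).2 hp⟩,
      fun x hx => (hvw hx.1).trans (hpw x hx.2)⟩
  choose m hm using h2
  exact ⟨m, hv, hvh, hm⟩

/-- The load `v ↦ (f, v)` on `H¹(U)`. -/
def load (hU : IsOpen U) {f : Plane → ℝ} (hf : MemLp f 2 (volume.restrict U)) :
    h1Space hU →ₗ[ℝ] ℝ where
  toFun v := ∫ x in U, f x * (v : Plane → ℝ) x
  map_add' u v := by
    rw [← integral_add (integrable_mul_of_memLp_two hf (MemH1.memLp u.2))
      (integrable_mul_of_memLp_two hf (MemH1.memLp v.2))]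
    exact integral_congr_ae (Eventually.of_forall fun x => mul_add _ _ _)
  map_smul' c u := by
    rw [RingHom.id_apply, smul_eq_mul, ← integral_const_mul]
    exact integral_congr_ae (Eventually.of_forall fun x => mul_left_comm _ _ _)

theorem load_eq_zero (hU : IsOpen U) {f : Plane → ℝ} (hf : MemLp f 2 (volume.restrict U))
    {v : h1Space hU} (hv : (v : Plane → ℝ) =ᵐ[volume.restrict U] 0) : load hU hf v = 0 := by
  refine integral_eq_zero_of_ae ?_
  filter_upwards [hv] with x hx
  rw [hx]
  exact mul_zero _

/-- The Riesz argument on gradients of interpolants. The polynomial pieces determine v_h almost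
everywhere, which gives finite dimension; Poincaré shows that the load vanishes when ∇v_h = 0. -/
theorem exists_mem_interpolantSpace_dirichlet_eq (k : ℕ) (hΩ : IsOpen Ω)
    (h : IsTriangularMesh Ω 𝒯) {f : Plane → ℝ} (hf : MemLp f 2 (volume.restrict Ω)) :
    ∃ z ∈ interpolantSpace k hΩ h, ∀ y ∈ interpolantSpace k hΩ h,
      dirichlet Ω z.1.2 y.1.2 = load hΩ hf y.1.2 := by
  obtain ⟨z, hz, hzy⟩ := exists_mem_inner_eq (interpolantSpace k hΩ h)
    (gradMap hΩ ∘ₗ LinearMap.snd ℝ _ _) (load hΩ hf ∘ₗ LinearMap.snd ℝ _ _)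
    (by
      intro z hz hm
      have hz0 : (z.1.2 : Plane → ℝ) =ᵐ[volume.restrict Ω] (0 : h1Space hΩ) := by
        refine h.ae_restrict_of_forall_mem fun T hT x hx => ?_
        obtain ⟨i, hi⟩ := exists_mem_hctPiece (openTri_subset T hx)
        rw [hz.2.2 ⟨T, hT⟩ i x ⟨hx, hi⟩]
        simp [polyEval, hm]
      rw [LinearMap.comp_apply, LinearMap.snd_apply, gradMap_congr hΩ hz0, map_zero])
    (by
      intro z hz h0
      rw [LinearMap.comp_apply, LinearMap.snd_apply] at h0 ⊢
      exact load_eq_zero hΩ hf (ae_eq_zero_of_gradMap_eq_zero hΩ h.isBounded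
        (hz.2.1.memH10 hΩ h hz.1.memH10) h0))
  refine ⟨z, hz, fun y hy => ?_⟩
  rw [← inner_gradMap hΩ]
  exact hzy y hy

theorem exists_isVEMSolution (hΩ : IsOpen Ω) (h : IsTriangularMesh Ω 𝒯) (k : ℕ)
    {f : Plane → ℝ} (hf : MemLp f 2 (volume.restrict Ω)) :
    ∃ u uh : Plane → ℝ, IsVEMSolution k Ω 𝒯 f u uh := by
  obtain ⟨z, hz, hzy⟩ := exists_mem_interpolantSpace_dirichlet_eq k hΩ h hf
  refine ⟨z.1.1, z.1.2, hz.1, hz.2.1, fun v vh hv hvh => ?_⟩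
  have h1 := (hvh.memH10 hΩ h hv.memH10).memH1
  obtain ⟨m, hm⟩ := hvh.exists_mem_interpolantSpace hΩ h hv h1
  rw [← h.dirichlet_eq z.1.2.2 h1]
  exact hzy _ hm

/-- Testing both equations with the difference gives u_h - u_h' zero energy. Coercivity transfers
this to u - u', and Poincaré turns zero energy into equality in both cases. -/
theorem IsVEMSolution.ae_eq {f u' uh uh' : Plane → ℝ} (hΩ : IsOpen Ω)
    (h : IsTriangularMesh Ω 𝒯) (hu : IsVEMSolution k Ω 𝒯 f u uh)
    (hu' : IsVEMSolution k Ω 𝒯 f u' uh') :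
    u =ᵐ[volume.restrict Ω] u' ∧ uh =ᵐ[volume.restrict Ω] uh' := by
  have sub_eq : ∀ a b : Plane → ℝ, (fun x => a x + -1 * b x) = fun x => a x - b x := by
    intro a b; ext x; ring
  have hd := hu.memVirtual.add hΩ h (hu'.memVirtual.const_mul hΩ h (-1))
  have hdh := hu.isInterpolant.add h hu.memVirtual (hu'.memVirtual.const_mul hΩ h (-1))
    (hu'.isInterpolant.const_mul h (-1) hu'.memVirtual)
  rw [sub_eq] at hd hdh
  rw [sub_eq] at hdh
  have h1 := hu.isInterpolant.memH10 hΩ h hu.memVirtual.memH10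
  have h2 := hu'.isInterpolant.memH10 hΩ h hu'.memVirtual.memH10
  have h3 := hdh.memH10 hΩ h hd.memH10
  have h4 : dirichlet Ω (fun x => uh x - uh' x) (fun x => uh x - uh' x) = 0 := by
    rw [dirichlet_sub_left hΩ h1.memH1 h2.memH1 h3.memH1, h.dirichlet_eq h1.memH1 h3.memH1,
      h.dirichlet_eq h2.memH1 h3.memH1, hu.eq _ _ hd hdh, hu'.eq _ _ hd hdh, sub_self]
  obtain ⟨C, -, hC⟩ := exists_dirichlet_le_mul_brokenDirichlet k h
  have h5 := hC _ _ hd hdh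
  rw [← h.dirichlet_eq h3.memH1 h3.memH1, h4, mul_zero] at h5
  have h6 := ae_eq_zero_of_dirichlet_self_eq_zero hΩ h.isBounded hd.memH10
    (le_antisymm h5 (dirichlet_self_nonneg _ _))
  have h7 := ae_eq_zero_of_dirichlet_self_eq_zero hΩ h.isBounded h3 h4
  constructor
  · filter_upwards [h6] with x hx using sub_eq_zero.1 hx
  · filter_upwards [h7] with x hx using sub_eq_zero.1 hx

end VEM

end

/-! ### Interpolation, coercivity and unique solvability combined. -/

theorem lemma2p2 (k : ℕ) (hk : 1 ≤ k) (Ω : Set VEM.Plane) (hΩ : IsOpen Ω)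
    (𝒯 : Finset VEM.Triangle) (h𝒯 : VEM.IsTriangularMesh Ω 𝒯) :
    -- the interpolation is well defined on the virtual element space, with values in `H¹₀(Ω)`
    (∀ v : VEM.Plane → ℝ, VEM.MemVirtual k Ω 𝒯 v →
      (∃ vh : VEM.Plane → ℝ, VEM.IsInterpolant k 𝒯 v vh ∧ VEM.MemH10 Ω vh) ∧
      ∀ vh vh' : VEM.Plane → ℝ, VEM.IsInterpolant k 𝒯 v vh → VEM.IsInterpolant k 𝒯 v vh' →
        vh =ᵐ[volume.restrict Ω] vh') ∧
    -- the bilinear form without stabilizer is coercive on the virtual element space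
    (∃ α : ℝ, 0 < α ∧ ∀ v vh : VEM.Plane → ℝ, VEM.MemVirtual k Ω 𝒯 v →
      VEM.IsInterpolant k 𝒯 v vh →
        α * VEM.dirichlet Ω v v ≤ VEM.brokenDirichlet 𝒯 vh vh) ∧
    -- existence and uniqueness (as elements of `L²(Ω)`) of the solution
    (∀ f : VEM.Plane → ℝ, MemLp f 2 (volume.restrict Ω) →
      (∃ u uh : VEM.Plane → ℝ, VEM.IsVEMSolution k Ω 𝒯 f u uh) ∧
      ∀ u uh u' uh' : VEM.Plane → ℝ,
        VEM.IsVEMSolution k Ω 𝒯 f u uh → VEM.IsVEMSolution k Ω 𝒯 f u' uh' →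
          u =ᵐ[volume.restrict Ω] u' ∧ uh =ᵐ[volume.restrict Ω] uh') := by
  refine ⟨fun v hv => ⟨?_, fun vh vh' => VEM.IsInterpolant.ae_eq h𝒯⟩, ?_, fun f hf =>
    ⟨VEM.exists_isVEMSolution hΩ h𝒯 k hf, fun u uh u' uh' => VEM.IsVEMSolution.ae_eq hΩ h𝒯⟩⟩
  · obtain ⟨vh, hvh⟩ := VEM.exists_isInterpolant hk h𝒯 hv
    exact ⟨vh, hvh, hvh.memH10 hΩ h𝒯 hv.memH10⟩
  · obtain ⟨C, hC, hCv⟩ := VEM.exists_dirichlet_le_mul_brokenDirichlet k h𝒯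
    refine ⟨C⁻¹, inv_pos.2 hC, fun v vh hv hvh => ?_⟩
    rw [inv_mul_le_iff₀ hC]
    exact hCv v vh hv hvh
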